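/- Consider a discrete memoryless channel with $N$ relays: finite alphabets $\mathcal X$ (source input), $\mathcal X_i$ and $\mathcal Y_i$ (input and output of relay $i$, $1\le i\le N$), $\mathcal Y$ (destination output), and transition probabilities $p(y,y_1,\dots,y_N\mid x,x_1,\dots,x_N)$, the successive uses of the channel being memoryless. A $(2^{nR},n)$ code consists of $\lceil 2^{nR}\rceil$ messages, an encoder that maps each message to a word in $\mathcal X^n$, relay functions by which relay $i$ transmits at time $t$ a function of its own first $t-1$ channel outputs, and a decoder that maps each word in $\mathcal Y^n$ to a message. A rate $R$ is achievable if there is a sequence of $(2^{nR},n)$ codes, $n=1,2,\dots$, whose error probability, averaged over a uniformly distributed message, tends to $0$ as $n\to\infty$. Let $p(x),p(x_1),\dots,p(x_N)$ be any probability distributions on $\mathcal X,\mathcal X_1,\dots,\mathcal X_N$, let $(X,X_1,\dots,X_N,Y,Y_1,\dots,Y_N)$ have the joint distribution $$p(x)\,p(x_1)\cdots p(x_N)\,p(y,y_1,\dots,y_N\mid x,x_1,\dots,x_N),$$ and write $\mathbf X=(X_1,\dots,X_N)$ and $\mathbf Y_S=(Y_i)_{i\in S}$ for $S\subseteq\{1,\dots,N\}$.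 Entropies and mutual informations are in bits. Put $$q_i=\min\Big(1,\ \frac{I(X_i;Y)}{H(Y_i\mid \mathbf X,Y)}\Big),\qquad 1\le i\le N,$$ with $q_i=1$ if $H(Y_i\mid\mathbf X,Y)=0$, and $$R^*=I(X;Y\mid\mathbf X)+\sum_{\emptyset\ne S\subseteq\{1,\dots,N\}}\ \Big(\prod_{i\notin S}(1-q_i)\prod_{i\in S}q_i\Big)\, I(X;\mathbf Y_S\mid\mathbf X,Y).$$ Then every rate $R<R^*$ is achievable, and every $R\le R^*$ lies in the closure of the set of achievable rates. -/

import Mathlib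

open Filter Topology

noncomputable section

/-! ### Information measures of finite random variables, in bits

A random variable on a finite space `Ω` with probability mass function `p : Ω → ℝ` is a map
`f : Ω → α` into a finite type. -/

open Classical in
/-- The probability mass function of the random variable `f` under `p`. -/
def law {Ω α : Type*} [Fintype Ω] (p : Ω → ℝ) (f : Ω → α) (a : α) : ℝ :=
  ∑ ω, if f ω = a then p ω else 0

/-- `H(f | g) = - ∑ p(a, b) log₂ p(a | b)`; outcomes of probability zero contribute zero. -/
def condEntropy {Ω α β : Type*} [Fintype Ω] [Fintype α] [Fintype β]
    (p : Ω → ℝ) (f : Ω → α) (g : Ω → β) : ℝ :=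
  - ∑ a, ∑ b, law p (fun ω => (f ω, g ω)) (a, b) *
      Real.logb 2 (law p (fun ω => (f ω, g ω)) (a, b) / law p g b)

/-- `I(f ; g) = ∑ p(a, b) log₂ (p(a, b) / (p(a) p(b)))`; outcomes of probability zero
contribute zero. -/
def mutualInfo {Ω α β : Type*} [Fintype Ω] [Fintype α] [Fintype β]
    (p : Ω → ℝ) (f : Ω → α) (g : Ω → β) : ℝ :=
  ∑ a, ∑ b, law p (fun ω => (f ω, g ω)) (a, b) *
      Real.logb 2 (law p (fun ω => (f ω, g ω)) (a, b) / (law p f a * law p g b))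

/-- `I(f ; g | h) = H(f | h) - H(f | g, h)`. -/
def condMutualInfo {Ω α β γ : Type*} [Fintype Ω] [Fintype α] [Fintype β] [Fintype γ]
    (p : Ω → ℝ) (f : Ω → α) (g : Ω → β) (h : Ω → γ) : ℝ :=
  condEntropy p f h - condEntropy p f (fun ω => (g ω, h ω))

/-! ### The discrete memoryless channel with `N` relays -/

/-- A discrete channel with a source (input alphabet `X`), relays `i : Fin N` (input alphabets
`XR i`, output alphabets `YR i`) and a destination (output alphabet `Y`):
`prob x xs (y, ys)` is `p(y, y₁, …, y_N | x, x₁, …, x_N)`. -/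
structure RelayChannel (N : ℕ) (X Y : Type*) (XR YR : Fin N → Type*)
    [Fintype Y] [∀ i, Fintype (YR i)] where
  prob : X → (∀ i, XR i) → Y × (∀ i, YR i) → ℝ
  prob_mem : ∀ x xs, prob x xs ∈ stdSimplex ℝ (Y × (∀ i, YR i))

/-- A code of block length `n` with `M` messages. At the time `t` (counted from `0`) relay `i`
transmits a function of its `t` previous channel outputs. -/
structure RelayCode {N : ℕ} (X Y : Type*) (XR YR : Fin N → Type*) (n M : ℕ) where
  enc : Fin M → Fin n → X
  relay : ∀ (i : Fin N) (t : Fin n), (Fin (t : ℕ) → YR i) → XR i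
  dec : (Fin n → Y) → Fin M

/-- The vector of the symbols transmitted by the relays at time `t`, when `ys s i` is the output
of the channel at relay `i` at time `s`. -/
def RelayCode.relayInput {N : ℕ} {X Y : Type*} {XR YR : Fin N → Type*} {n M : ℕ}
    (c : RelayCode X Y XR YR n M) (ys : Fin n → ∀ i, YR i) (t : Fin n) (i : Fin N) : XR i :=
  c.relay i t (fun s => ys (Fin.castLE t.isLt.le s) i)

section Channel

variable {N : ℕ} {X Y : Type*} {XR YR : Fin N → Type*}
  [Fintype X] [Fintype Y] [∀ i, Fintype (XR i)] [∀ i, Fintype (YR i)]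

/-- The probability that the memoryless channel `W`, used with the code `c` to send the message
`w`, produces the outputs `y` at the destination and `ys` at the relays. -/
def RelayCode.blockProb (W : RelayChannel N X Y XR YR) {n M : ℕ} (c : RelayCode X Y XR YR n M)
    (w : Fin M) (y : Fin n → Y) (ys : Fin n → ∀ i, YR i) : ℝ :=
  ∏ t, W.prob (c.enc w t) (c.relayInput ys t) (y t, ys t)

/-- The average probability of error `Pr(g(Yⁿ) ≠ w)` for a uniformly distributed message `w`. -/
def RelayCode.errorProb (W : RelayChannel N X Y XR YR) {n M : ℕ}
    (c : RelayCode X Y XR YR n M) : ℝ :=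
  (∑ w, ∑ y : Fin n → Y, ∑ ys : Fin n → ∀ i, YR i,
    if c.dec y ≠ w then c.blockProb W w y ys else 0) / M

/-- The rate `R` (in bits per channel use) is achievable: there is a sequence of `(2^{nR}, n)`
codes, with `⌈2^{nR}⌉` messages, whose average probability of error tends to zero. -/
def RelayChannel.Achievable (W : RelayChannel N X Y XR YR) (R : ℝ) : Prop :=
  ∃ c : ∀ n : ℕ, RelayCode X Y XR YR n ⌈(2 : ℝ) ^ ((n : ℝ) * R)⌉₊,
    Tendsto (fun n => (c n).errorProb W) atTop (𝓝 0)

/-- The joint law `p(x) p(x₁) ⋯ p(x_N) p(y, y₁, …, y_N | x, x₁, …, x_N)`. -/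
def RelayChannel.joint (W : RelayChannel N X Y XR YR) (pX : X → ℝ) (pR : ∀ i, XR i → ℝ)
    (ω : X × (∀ i, XR i) × Y × (∀ i, YR i)) : ℝ :=
  pX ω.1 * (∏ i, pR i (ω.2.1 i)) * W.prob ω.1 ω.2.1 (ω.2.2.1, ω.2.2.2)

/-- `q_i = min (1, I(X_i; Y) / H(Y_i | X₁, …, X_N, Y))`, which is `1` when the denominator is
zero. -/
def RelayChannel.q (W : RelayChannel N X Y XR YR) (pX : X → ℝ) (pR : ∀ i, XR i → ℝ)
    (i : Fin N) : ℝ :=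
  let p := W.joint pX pR
  let I := mutualInfo p (fun ω => ω.2.1 i) (fun ω => ω.2.2.1)
  let H := condEntropy p (fun ω => ω.2.2.2 i) (fun ω => (ω.2.1, ω.2.2.1))
  if H = 0 then 1 else min 1 (I / H)

/-- `I(X; Y | 𝐗) + ∑_{S ≠ ∅} ∏_{i ∉ S} (1 - q_i) ∏_{i ∈ S} q_i · I(X; 𝐘_S | 𝐗, Y)`, where
`𝐗 = (X₁, …, X_N)` and `𝐘_S = (Y_i)_{i ∈ S}`; the nonempty sets `S` of relays are the sets of
positions of the digit `1` in the `N`-bit binary expansions of `1, …, 2^N - 1`. -/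
def RelayChannel.rateBound (W : RelayChannel N X Y XR YR) (pX : X → ℝ)
    (pR : ∀ i, XR i → ℝ) : ℝ :=
  let p := W.joint pX pR
  condMutualInfo p (fun ω => ω.1) (fun ω => ω.2.2.1) (fun ω => ω.2.1) +
    ∑ S : Finset (Fin N) with S.Nonempty,
      ((∏ i ∈ Sᶜ, (1 - W.q pX pR i)) * ∏ i ∈ S, W.q pX pR i) *
        condMutualInfo p (fun ω => ω.1) (fun ω => fun i : S => ω.2.2.2 i)
          (fun ω => (ω.2.1, ω.2.2.1))

end Channel

end

/-!
Compress-and-forward with random masks, over `B + 1` blocks of `m` channel uses.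

In each block the source sends a fresh codeword and relay `i` sends the codeword of an index in
`Fin (K i)`, namely a random hash of its outputs in the previous block. A random mask, known to
everybody, selects the channel uses whose outputs relay `i` reports; each is selected with
probability `q i`, independently of everything else. The destination first decodes the indices
from its own output, which works if `log₂ (K i) < m I(Xᵢ; Y)`. In the previous block it then knows
all relay inputs, its own output, and a hash of the masked output of relay `i`. By random binning
the hash determines the masked output if `log₂ (K i) > m q i H(Yᵢ | 𝐗, Y)`. Finally it decodes the
source codeword from its output and the masked outputs. Since the mask is a Bernoulli subset of the
relays at each time, the rate of this last step is the average over `S` of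
`I(X; Y, 𝐘_S | 𝐗) = I(X; Y | 𝐗) + I(X; 𝐘_S | 𝐗, Y)`, which is `rateBound`
(`RelayChannel.sum_letterLaw_logb_φ`).

The argument has four parts.

* `Experiment.exists_codebook` is a one-shot version for a single block: it averages over a random
  codebook, and bounds wrong decisions by Markov's inequality for scores whose average is at most
  `1`. The averages over wrong candidates come from `sum_exchange`, which resamples one entry of the
  codebook. Since the bound holds for each message and each tuple of indices, a good codebook exists
  for every joint law of message and indices, in particular for the one that the earlier blocks
  induce. Hence the codebooks are fixed one block after the other.
* `Experiment.pow` repeats a one-letter experiment `m` times, and the law of large numbers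
  (`Experiment.tendsto_mean_pow_iverson_lt`) shows that the true scores are large.
* `RelayChannel.AidedCode.step` appends a block. The induction runs over codes whose destination
  learns the last hashes for free; only the digit of the message sent in the last block depends on
  them, and this digit is not used in the end.
* In `RelayChannel.exists_thresholds` the numbers `K i` are chosen. If `I(Xᵢ; Y) > 0`, lowering
  `q i` slightly makes room for exponents strictly between `q i H(Yᵢ | 𝐗, Y)` and `I(Xᵢ; Y)`. If
  `I(Xᵢ; Y) = 0`, then the masked outputs are functions of `(𝐗, Y)`, and `K i = 1` suffices.
-/

noncomputable section

/-! ### Finite averages -/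

/-- The Iverson bracket: `1` if `P` holds and `0` otherwise. -/
def iverson (P : Prop) : ℝ := open Classical in if P then 1 else 0

theorem iverson_true {P : Prop} (h : P) : iverson P = 1 := if_pos h

theorem iverson_false {P : Prop} (h : ¬ P) : iverson P = 0 := if_neg h

theorem iverson_nonneg (P : Prop) : 0 ≤ iverson P := by
  unfold iverson; split_ifs <;> norm_num

theorem iverson_mono {P Q : Prop} (h : P → Q) : iverson P ≤ iverson Q := by
  by_cases hP : P
  · rw [iverson_true hP, iverson_true (h hP)]
  · rw [iverson_false hP]; exact iverson_nonneg Q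

theorem iverson_or_le (P Q : Prop) : iverson (P ∨ Q) ≤ iverson P + iverson Q := by
  by_cases hP : P
  · rw [iverson_true hP, iverson_true (Or.inl hP)]
    linarith [iverson_nonneg Q]
  · have := iverson_nonneg P
    exact (iverson_mono (fun h => h.resolve_left hP)).trans (by linarith)

theorem iverson_exists_le {α : Type*} [Fintype α] (P : α → Prop) :
    iverson (∃ a, P a) ≤ ∑ a, iverson (P a) := by
  by_cases h : ∃ a, P a
  · obtain ⟨a, ha⟩ := h
    rw [iverson_true ⟨a, ha⟩, ← iverson_true ha]
    exact Finset.single_le_sum (f := fun a => iverson (P a))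
      (fun b _ => iverson_nonneg _) (Finset.mem_univ a)
  · rw [iverson_false h]
    exact Finset.sum_nonneg fun b _ => iverson_nonneg _

/-- Markov's inequality for the Iverson bracket of a threshold event. -/
theorem iverson_le_div {a b : ℝ} (ha : 0 < a) (hb : 0 ≤ b) : iverson (a ≤ b) ≤ b / a := by
  by_cases h : a ≤ b
  · rw [iverson_true h, le_div_iff₀ ha]; linarith
  · rw [iverson_false h]; positivity

/-- If the coordinate `get c` of a random `c` with weights `w` has law `v` and is independent of
the remaining coordinates, then resampling it does not change averages. -/
theorem sum_exchange {C B : Type*} [Fintype C] [Fintype B] {w : C → ℝ} {v : B → ℝ}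
    (get : C → B) (set : C → B → C) (hv : ∑ b, v b = 1)
    (h1 : ∀ c b, get (set c b) = b) (h2 : ∀ c b, set (set c b) (get c) = c)
    (h3 : ∀ c b, w (set c b) * v (get c) = w c * v b) (F : C → ℝ) :
    ∑ c, w c * F c = ∑ c, w c * ∑ b, v b * F (set c b) := by
  -- `(c, b) ↦ (set c b, get c)` is an involution that preserves the product weight.
  let e : C × B ≃ C × B :=
    { toFun := fun q => (set q.1 q.2, get q.1)
      invFun := fun q => (set q.1 q.2, get q.1)
      left_inv := fun q => by simp [h1, h2]
      right_inv := fun q => by simp [h1, h2] }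
  calc ∑ c, w c * F c = ∑ q : C × B, w q.1 * v q.2 * F q.1 := by
        rw [Fintype.sum_prod_type]
        refine Finset.sum_congr rfl fun c _ => ?_
        rw [← mul_one (w c * F c), ← hv, Finset.mul_sum]
        exact Finset.sum_congr rfl fun b _ => by ring
    _ = ∑ q : C × B, w q.1 * v q.2 * F (set q.1 q.2) := by
        rw [← e.sum_comp]
        refine Finset.sum_congr rfl fun q _ => ?_
        change w (set q.1 q.2) * v (get q.1) * _ = _
        rw [h3]
        rfl
    _ = ∑ c, w c * ∑ b, v b * F (set c b) := by
        rw [Fintype.sum_prod_type]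
        refine Finset.sum_congr rfl fun c _ => ?_
        rw [Finset.mul_sum]
        exact Finset.sum_congr rfl fun b _ => by ring

theorem prod_update_exchange {J : Type*} [Fintype J] [DecidableEq J] {α : J → Type*}
    (p : ∀ j, α j → ℝ) (c : ∀ j, α j) (j₀ : J) (a : α j₀) :
    (∏ j, p j (Function.update c j₀ a j)) * p j₀ (c j₀) = (∏ j, p j (c j)) * p j₀ a := by
  rw [Fintype.prod_eq_mul_prod_compl j₀, Fintype.prod_eq_mul_prod_compl j₀ (fun j => p j (c j))]
  have : ∏ j ∈ {j₀}ᶜ, p j (Function.update c j₀ a j) = ∏ j ∈ {j₀}ᶜ, p j (c j) := by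
    refine Finset.prod_congr rfl fun j hj => ?_
    rw [Function.update_of_ne (by simpa using hj)]
  rw [this, Function.update_self]
  ring

theorem sum_pi_prod {J : Type*} [Fintype J] [DecidableEq J] {α : J → Type*} [∀ j, Fintype (α j)]
    (p : ∀ j, α j → ℝ) : ∑ c : ∀ j, α j, ∏ j, p j (c j) = ∏ j, ∑ a, p j a := by
  rw [Finset.prod_univ_sum, Fintype.piFinset_univ]

theorem sum_prod_four {A B C D : Type*} [Fintype A] [Fintype B] [Fintype C] [Fintype D]
    (a : A → ℝ) (b : B → ℝ) (c : C → ℝ) (d : D → ℝ) :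
    ∑ q : A × B × C × D, a q.1 * b q.2.1 * c q.2.2.1 * d q.2.2.2 =
      (∑ x, a x) * (∑ x, b x) * (∑ x, c x) * ∑ x, d x := by
  simp only [Fintype.sum_prod_type, ← Finset.mul_sum, ← Finset.sum_mul]

theorem exists_le_of_sum_mul_le {C : Type*} [Fintype C] {w J : C → ℝ} {b : ℝ}
    (hw : ∀ c, 0 ≤ w c) (hw1 : ∑ c, w c = 1) (h : ∑ c, w c * J c ≤ b) : ∃ c, J c ≤ b := by
  by_contra! hc
  have hne : ∃ c ∈ Finset.univ, 0 < w c := by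
    by_contra! h0
    have : ∑ c, w c ≤ 0 := Finset.sum_nonpos h0
    linarith
  have : ∑ c, w c * b < ∑ c, w c * J c := by
    obtain ⟨c, hcm, hc0⟩ := hne
    exact Finset.sum_lt_sum (fun c _ => mul_le_mul_of_nonneg_left (hc c).le (hw c))
      ⟨c, hcm, mul_lt_mul_of_pos_left (hc c) hc0⟩
  rw [← Finset.sum_mul, hw1, one_mul] at this
  linarith

theorem epsilon_eq_of_unique {α : Type*} [Nonempty α] {P : α → Prop} {a : α} (ha : P a)
    (h : ∀ b, b ≠ a → ¬ P b) : Classical.epsilon P = a := by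
  by_contra hne
  exact h _ hne (Classical.epsilon_spec ⟨a, ha⟩)

/-! ### Random codebooks for one block -/

/-- A random experiment on a channel used once by the source and by relays `i : ι`, with the tests
that the destination applies. A variable `T ~ pT` known to everybody is drawn, the inputs `x ~ pX`
and `xs i ~ pR i` are independent, `V x xs` is the law of the output `o`, the destination sees
`yOf o`, and relay `i` wants to report `zOf T o i`. The scores `f`, `g`, `φ` compare a candidate for
a relay input, for a report, and for the source input with what the destination knows; the
normalizations `f_sum`, `g_sum`, `φ_sum` make high scores of wrong candidates rare. -/
structure Experiment (ι 𝒯 𝒳 𝒴 𝒪 : Type*) (𝒳r 𝒵 : ι → Type*) [Fintype ι] [Fintype 𝒯] [Fintype 𝒳]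
    [Fintype 𝒪] [∀ i, Fintype (𝒳r i)] [∀ i, Fintype (𝒵 i)] where
  V : 𝒳 → (∀ i, 𝒳r i) → 𝒪 → ℝ
  V_nonneg : ∀ x xs o, 0 ≤ V x xs o
  V_sum : ∀ x xs, ∑ o, V x xs o = 1
  yOf : 𝒪 → 𝒴
  zOf : 𝒯 → 𝒪 → ∀ i, 𝒵 i
  pT : 𝒯 → ℝ
  pT_nonneg : ∀ T, 0 ≤ pT T
  pT_sum : ∑ T, pT T = 1
  pX : 𝒳 → ℝ
  pX_nonneg : ∀ x, 0 ≤ pX x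
  pX_sum : ∑ x, pX x = 1
  pR : ∀ i, 𝒳r i → ℝ
  pR_nonneg : ∀ i x, 0 ≤ pR i x
  pR_sum : ∀ i, ∑ x, pR i x = 1
  f : ∀ i, 𝒳r i → 𝒴 → ℝ
  f_nonneg : ∀ i x y, 0 ≤ f i x y
  f_sum : ∀ i y, ∑ x, pR i x * f i x y ≤ 1
  g : ∀ i, 𝒯 → (∀ j, 𝒳r j) → 𝒴 → 𝒵 i → ℝ
  g_nonneg : ∀ i T xs y z, 0 ≤ g i T xs y z
  g_sum : ∀ i T xs y, ∑ z, g i T xs y z ≤ 1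
  φ : 𝒯 → (∀ j, 𝒳r j) → 𝒴 → (∀ i, 𝒵 i) → 𝒳 → ℝ
  φ_nonneg : ∀ T xs y z x, 0 ≤ φ T xs y z x
  φ_sum : ∀ T xs y z, ∑ x, pX x * φ T xs y z x ≤ 1

namespace Experiment

section

variable {ι 𝒯 𝒳 𝒴 𝒪 : Type*} {𝒳r 𝒵 : ι → Type*} [Fintype ι] [Fintype 𝒯] [Fintype 𝒳]
  [Fintype 𝒪] [∀ i, Fintype (𝒳r i)] [∀ i, Fintype (𝒵 i)]
  (E : Experiment ι 𝒯 𝒳 𝒴 𝒪 𝒳r 𝒵)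

/-- A codebook: a value of the common variable `T`, a source input for each message, an input of
relay `i` for each index `k : κ i` that it may transmit, and a hash of each report of relay `i`. -/
abbrev Codebook (𝒯 𝒳 𝓦 : Type*) (𝒳r 𝒵 κ κ' : ι → Type*) : Type _ :=
  𝒯 × (𝓦 → 𝒳) × (∀ i, κ i → 𝒳r i) × (∀ i, 𝒵 i → κ' i)

variable {𝓦 : Type*} {κ κ' : ι → Type*} [Fintype 𝓦] [∀ i, Fintype (κ i)] [∀ i, Fintype (κ' i)]

/-- The law of a random codebook: `T ~ pT`, independent codewords of laws `pX` and `pR i`, and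
uniformly distributed hashes. -/
def weight (C : Codebook 𝒯 𝒳 𝓦 𝒳r 𝒵 κ κ') : ℝ :=
  E.pT C.1 * (∏ w, E.pX (C.2.1 w)) * (∏ i, ∏ k, E.pR i (C.2.2.1 i k)) *
    ∏ i, ∏ _z : 𝒵 i, (Fintype.card (κ' i) : ℝ)⁻¹

theorem weight_nonneg (C : Codebook 𝒯 𝒳 𝓦 𝒳r 𝒵 κ κ') : 0 ≤ E.weight C := by
  unfold weight
  have h1 := E.pT_nonneg C.1
  have h2 : 0 ≤ ∏ w, E.pX (C.2.1 w) := Finset.prod_nonneg fun w _ => E.pX_nonneg _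
  have h3 : 0 ≤ ∏ i, ∏ k, E.pR i (C.2.2.1 i k) :=
    Finset.prod_nonneg fun i _ => Finset.prod_nonneg fun k _ => E.pR_nonneg _ _
  positivity

variable [DecidableEq ι]

/-- The expectation of `Φ` in the experiment. -/
def mean (Φ : 𝒯 → 𝒳 → (∀ i, 𝒳r i) → 𝒪 → ℝ) : ℝ :=
  ∑ a : 𝒯 × 𝒳 × (∀ i, 𝒳r i),
    E.pT a.1 * E.pX a.2.1 * (∏ i, E.pR i (a.2.2 i)) * ∑ o, E.V a.2.1 a.2.2 o * Φ a.1 a.2.1 a.2.2 o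

open Classical in
theorem weight_sum [∀ i, Nonempty (κ' i)] : ∑ C : Codebook 𝒯 𝒳 𝓦 𝒳r 𝒵 κ κ', E.weight C = 1 := by
  have hx : ∑ c : 𝓦 → 𝒳, ∏ w, E.pX (c w) = 1 := by
    rw [sum_pi_prod (fun _ => E.pX)]; simp [E.pX_sum]
  have hr : ∑ c : ∀ i, κ i → 𝒳r i, ∏ i, ∏ k, E.pR i (c i k) = 1 := by
    rw [sum_pi_prod (α := fun i => κ i → 𝒳r i) (fun i c => ∏ k, E.pR i (c k))]
    refine Finset.prod_eq_one fun i _ => ?_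
    rw [sum_pi_prod (fun _ => E.pR i)]; simp [E.pR_sum]
  have hh : ∑ _h : ∀ i, 𝒵 i → κ' i, ∏ i, ∏ _z : 𝒵 i, (Fintype.card (κ' i) : ℝ)⁻¹ = 1 := by
    rw [sum_pi_prod (α := fun i => 𝒵 i → κ' i)
      (fun i _ => ∏ _z : 𝒵 i, (Fintype.card (κ' i) : ℝ)⁻¹)]
    refine Finset.prod_eq_one fun i _ => ?_
    rw [sum_pi_prod (α := fun _ => κ' i) (fun _ _ => (Fintype.card (κ' i) : ℝ)⁻¹)]
    simp
  calc ∑ C : Codebook 𝒯 𝒳 𝓦 𝒳r 𝒵 κ κ', E.weight C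
      = (∑ T, E.pT T) * (∑ c : 𝓦 → 𝒳, ∏ w, E.pX (c w)) *
        (∑ c : ∀ i, κ i → 𝒳r i, ∏ i, ∏ k, E.pR i (c i k)) *
        ∑ _h : ∀ i, 𝒵 i → κ' i, ∏ i, ∏ _z : 𝒵 i, (Fintype.card (κ' i) : ℝ)⁻¹ := by
        rw [← sum_prod_four]; rfl
    _ = 1 := by rw [hx, hr, hh, E.pT_sum]; norm_num

open Classical in
/-- The entries of a random codebook that are used for message `w` and indices `s` have the law of
the experiment. -/
theorem sum_weight_transmitted [∀ i, Nonempty (κ' i)] (w : 𝓦) (s : ∀ i, κ i)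
    (F : 𝒯 → 𝒳 → (∀ i, 𝒳r i) → ℝ) :
    ∑ C : Codebook 𝒯 𝒳 𝓦 𝒳r 𝒵 κ κ', E.weight C * F C.1 (C.2.1 w) (fun i => C.2.2.1 i (s i)) =
      ∑ a : 𝒯 × 𝒳 × (∀ i, 𝒳r i),
        E.pT a.1 * E.pX a.2.1 * (∏ i, E.pR i (a.2.2 i)) * F a.1 a.2.1 a.2.2 := by
  have hv : ∑ a : 𝒯 × 𝒳 × (∀ i, 𝒳r i), E.pT a.1 * E.pX a.2.1 * (∏ i, E.pR i (a.2.2 i)) = 1 := by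
    simp only [Fintype.sum_prod_type, ← Finset.mul_sum, ← Finset.sum_mul]
    rw [sum_pi_prod E.pR]
    simp [E.pT_sum, E.pX_sum, E.pR_sum]
  rw [sum_exchange (w := E.weight) (v := fun a : 𝒯 × 𝒳 × (∀ i, 𝒳r i) =>
      E.pT a.1 * E.pX a.2.1 * (∏ i, E.pR i (a.2.2 i)))
    (fun C => (C.1, C.2.1 w, fun i => C.2.2.1 i (s i)))
    (fun C a => (a.1, Function.update C.2.1 w a.2.1,
      (fun i => Function.update (C.2.2.1 i) (s i) (a.2.2 i)), C.2.2.2)) hv]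
  · simp only [Function.update_self]
    rw [← Finset.sum_mul, weight_sum, one_mul]
  · intro c b; simp
  · intro c b; simp
  · intro c b
    have h1 := prod_update_exchange (fun _ => E.pX) c.2.1 w b.2.1
    have h2 : (∏ i, ∏ k, E.pR i (Function.update (c.2.2.1 i) (s i) (b.2.2 i) k)) *
        ∏ i, E.pR i (c.2.2.1 i (s i)) =
        (∏ i, ∏ k, E.pR i (c.2.2.1 i k)) * ∏ i, E.pR i (b.2.2 i) := by
      rw [← Finset.prod_mul_distrib, ← Finset.prod_mul_distrib]
      exact Finset.prod_congr rfl fun i _ =>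
        prod_update_exchange (fun _ => E.pR i) (c.2.2.1 i) (s i) (b.2.2 i)
    simp only [weight]
    linear_combination (E.pT b.1 * E.pT c.1 * (∏ i, ∏ _z : 𝒵 i, (Fintype.card (κ' i) : ℝ)⁻¹)) *
      ((∏ i, ∏ k, E.pR i (Function.update (c.2.2.1 i) (s i) (b.2.2 i) k)) *
        (∏ i, E.pR i (c.2.2.1 i (s i))) * h1 +
      (∏ w, E.pX (c.2.1 w)) * E.pX b.2.1 * h2)

open Classical in
theorem sum_weight_resample_message (w : 𝓦) (F : Codebook 𝒯 𝒳 𝓦 𝒳r 𝒵 κ κ' → ℝ) :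
    ∑ C, E.weight C * F C = ∑ C, E.weight C *
      ∑ a, E.pX a * F (C.1, Function.update C.2.1 w a, C.2.2) := by
  refine sum_exchange (fun C => C.2.1 w) (fun C a => (C.1, Function.update C.2.1 w a, C.2.2))
    E.pX_sum (fun c b => by simp) (fun c b => by simp) (fun c b => ?_) F
  have h1 := prod_update_exchange (fun _ => E.pX) c.2.1 w b
  simp only [weight]
  linear_combination (E.pT c.1 * (∏ i, ∏ k, E.pR i (c.2.2.1 i k)) *
    (∏ i, ∏ _z : 𝒵 i, (Fintype.card (κ' i) : ℝ)⁻¹)) * h1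

open Classical in
theorem sum_weight_resample_relay (i : ι) (k : κ i) (F : Codebook 𝒯 𝒳 𝓦 𝒳r 𝒵 κ κ' → ℝ) :
    ∑ C, E.weight C * F C = ∑ C, E.weight C *
      ∑ a, E.pR i a * F (C.1, C.2.1,
        Function.update C.2.2.1 i (Function.update (C.2.2.1 i) k a), C.2.2.2) := by
  refine sum_exchange (fun C => C.2.2.1 i k) (fun C a => (C.1, C.2.1,
        Function.update C.2.2.1 i (Function.update (C.2.2.1 i) k a), C.2.2.2))
    (E.pR_sum i) (fun c b => by simp) (fun c b => by simp) (fun c b => ?_) F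
  have h1 : (∏ j, ∏ l, E.pR j
      (Function.update c.2.2.1 i (Function.update (c.2.2.1 i) k b) j l)) * E.pR i (c.2.2.1 i k) =
      (∏ j, ∏ l, E.pR j (c.2.2.1 j l)) * E.pR i b := by
    rw [Fintype.prod_eq_mul_prod_compl i,
      Fintype.prod_eq_mul_prod_compl i (fun j => ∏ l, E.pR j (c.2.2.1 j l))]
    have h2 : ∏ j ∈ {i}ᶜ, ∏ l, E.pR j
        (Function.update c.2.2.1 i (Function.update (c.2.2.1 i) k b) j l) =
        ∏ j ∈ {i}ᶜ, ∏ l, E.pR j (c.2.2.1 j l) := by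
      refine Finset.prod_congr rfl fun j hj => ?_
      rw [Function.update_of_ne (by simpa using hj)]
    have h3 := prod_update_exchange (fun _ => E.pR i) (c.2.2.1 i) k b
    rw [h2, Function.update_self]
    linear_combination (∏ j ∈ {i}ᶜ, ∏ l, E.pR j (c.2.2.1 j l)) * h3
  simp only [weight]
  linear_combination (E.pT c.1 * (∏ w, E.pX (c.2.1 w)) *
    (∏ i, ∏ _z : 𝒵 i, (Fintype.card (κ' i) : ℝ)⁻¹)) * h1

open Classical in
theorem sum_weight_resample_hash [∀ i, Nonempty (κ' i)] (i : ι) (z : 𝒵 i)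
    (F : Codebook 𝒯 𝒳 𝓦 𝒳r 𝒵 κ κ' → ℝ) :
    ∑ C, E.weight C * F C = ∑ C, E.weight C *
      ∑ a, (Fintype.card (κ' i) : ℝ)⁻¹ * F (C.1, C.2.1, C.2.2.1,
        Function.update C.2.2.2 i (Function.update (C.2.2.2 i) z a)) := by
  refine sum_exchange (w := E.weight) (v := fun _ : κ' i => (Fintype.card (κ' i) : ℝ)⁻¹)
    (fun C => C.2.2.2 i z) (fun C a => (C.1, C.2.1, C.2.2.1,
      Function.update C.2.2.2 i (Function.update (C.2.2.2 i) z a)))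
    (by simp) (fun c b => by simp) (fun c b => by simp) (fun c b => rfl) F

end

end Experiment

namespace Experiment

section

variable {ι 𝒯 𝒳 𝒴 𝒪 : Type*} {𝒳r 𝒵 : ι → Type*} [Fintype ι] [Fintype 𝒯] [Fintype 𝒳]
  [Fintype 𝒪] [∀ i, Fintype (𝒳r i)] [∀ i, Fintype (𝒵 i)]
  (E : Experiment ι 𝒯 𝒳 𝒴 𝒪 𝒳r 𝒵) {𝓦 : Type*} {κ κ' : ι → Type*}

theorem sum_V_mul_le {x : 𝒳} {xs : ∀ i, 𝒳r i} {F : 𝒪 → ℝ} {b : ℝ} (h : ∀ o, F o ≤ b) :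
    ∑ o, E.V x xs o * F o ≤ b :=
  calc ∑ o, E.V x xs o * F o ≤ ∑ o, E.V x xs o * b :=
        Finset.sum_le_sum fun o _ => mul_le_mul_of_nonneg_left (h o) (E.V_nonneg _ _ _)
    _ = b := by rw [← Finset.sum_mul, E.V_sum, one_mul]

/-- The index of relay `i` that the destination decodes: one whose codeword has a high score. -/
def decodeIndex [∀ i, Nonempty (κ i)] (A : ι → ℝ) (C : Codebook 𝒯 𝒳 𝓦 𝒳r 𝒵 κ κ') (y : 𝒴) (i : ι) :
    κ i :=
  Classical.epsilon fun k => A i ≤ E.f i (C.2.2.1 i k) y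

/-- The report of relay `i` that the destination decodes: one with a high score and the hash that
it has received. -/
def decodeReport [∀ i, Nonempty (𝒵 i)] (G : ι → ℝ) (C : Codebook 𝒯 𝒳 𝓦 𝒳r 𝒵 κ κ') (y : 𝒴)
    (s : ∀ i, κ i) (h : ∀ i, κ' i) (i : ι) : 𝒵 i :=
  Classical.epsilon fun z =>
    (G i)⁻¹ ≤ E.g i C.1 (fun i => C.2.2.1 i (s i)) y z ∧ C.2.2.2 i z = h i

/-- The message that the destination decodes: one whose codeword has a high score, given the
decoded reports. -/
def decodeMessage [Nonempty 𝓦] [∀ i, Nonempty (𝒵 i)] (G : ι → ℝ) (F : ℝ)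
    (C : Codebook 𝒯 𝒳 𝓦 𝒳r 𝒵 κ κ') (y : 𝒴) (s : ∀ i, κ i) (h : ∀ i, κ' i) : 𝓦 :=
  Classical.epsilon fun w =>
    F ≤ E.φ C.1 (fun i => C.2.2.1 i (s i)) y (E.decodeReport G C y s h) (C.2.1 w)

/-- If the decoding of a block fails, then some true score is too low, or some wrong candidate
has a high score. -/
theorem decoding_failure [Nonempty 𝓦] [∀ i, Nonempty (κ i)] [∀ i, Nonempty (𝒵 i)]
    {A G : ι → ℝ} {F : ℝ} {C : Codebook 𝒯 𝒳 𝓦 𝒳r 𝒵 κ κ'} {w : 𝓦} {s : ∀ i, κ i} {o : 𝒪}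
    (h : E.decodeIndex A C (E.yOf o) ≠ s ∨
      E.decodeMessage G F C (E.yOf o) s (fun i => C.2.2.2 i (E.zOf C.1 o i)) ≠ w) :
    (∃ i, E.f i (C.2.2.1 i (s i)) (E.yOf o) < A i) ∨
    (∃ i, ∃ k, k ≠ s i ∧ A i ≤ E.f i (C.2.2.1 i k) (E.yOf o)) ∨
    (∃ i, E.g i C.1 (fun i => C.2.2.1 i (s i)) (E.yOf o) (E.zOf C.1 o i) < (G i)⁻¹) ∨
    (∃ i, ∃ z, (z ≠ E.zOf C.1 o i ∧
        (G i)⁻¹ ≤ E.g i C.1 (fun i => C.2.2.1 i (s i)) (E.yOf o) (E.zOf C.1 o i) ∧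
        (G i)⁻¹ ≤ E.g i C.1 (fun i => C.2.2.1 i (s i)) (E.yOf o) z) ∧
        C.2.2.2 i z = C.2.2.2 i (E.zOf C.1 o i)) ∨
    E.φ C.1 (fun i => C.2.2.1 i (s i)) (E.yOf o) (E.zOf C.1 o) (C.2.1 w) < F ∨
    (∃ v, v ≠ w ∧ F ≤ E.φ C.1 (fun i => C.2.2.1 i (s i)) (E.yOf o) (E.zOf C.1 o) (C.2.1 v)) := by
  by_contra! hc
  obtain ⟨h1, h2, h3, h4, h5, h6⟩ := hc
  have hS : E.decodeIndex A C (E.yOf o) = s :=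
    funext fun i => epsilon_eq_of_unique (h1 i) fun k hk => not_le.2 (h2 i k hk)
  have hZ : E.decodeReport G C (E.yOf o) s (fun i => C.2.2.2 i (E.zOf C.1 o i)) = E.zOf C.1 o :=
    funext fun i => epsilon_eq_of_unique ⟨h3 i, rfl⟩ fun z hz hz' =>
      h4 i z ⟨hz, h3 i, hz'.1⟩ hz'.2
  refine h.elim (fun h => h hS) fun h => h ?_
  unfold decodeMessage
  rw [hZ]
  exact epsilon_eq_of_unique h5 fun v hv => not_le.2 (h6 v hv)

variable [DecidableEq ι] [Fintype 𝓦] [∀ i, Fintype (κ i)] [∀ i, Fintype (κ' i)]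

open Classical in
theorem sum_weight_mul_le [∀ i, Nonempty (κ' i)] {F : Codebook 𝒯 𝒳 𝓦 𝒳r 𝒵 κ κ' → ℝ} {b : ℝ}
    (h : ∀ C, F C ≤ b) : ∑ C, E.weight C * F C ≤ b :=
  calc ∑ C, E.weight C * F C ≤ ∑ C, E.weight C * b :=
        Finset.sum_le_sum fun C _ => mul_le_mul_of_nonneg_left (h C) (E.weight_nonneg _)
    _ = b := by rw [← Finset.sum_mul, weight_sum, one_mul]

/-- The average over a random codebook, and over the output when message `w` and the indices `s`
are sent, of `Φ`. -/
def codeMean (w : 𝓦) (s : ∀ i, κ i) (Φ : Codebook 𝒯 𝒳 𝓦 𝒳r 𝒵 κ κ' → 𝒪 → ℝ) : ℝ :=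
  open Classical in
  ∑ C, E.weight C * ∑ o, E.V (C.2.1 w) (fun i => C.2.2.1 i (s i)) o * Φ C o

theorem codeMean_mono (w : 𝓦) (s : ∀ i, κ i)
    {Φ Ψ : Codebook 𝒯 𝒳 𝓦 𝒳r 𝒵 κ κ' → 𝒪 → ℝ} (h : ∀ C o, Φ C o ≤ Ψ C o) :
    E.codeMean w s Φ ≤ E.codeMean w s Ψ :=
  Finset.sum_le_sum fun C _ => mul_le_mul_of_nonneg_left
    (Finset.sum_le_sum fun o _ => mul_le_mul_of_nonneg_left (h C o) (E.V_nonneg _ _ _))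
    (E.weight_nonneg _)

theorem codeMean_add (w : 𝓦) (s : ∀ i, κ i) (Φ Ψ : Codebook 𝒯 𝒳 𝓦 𝒳r 𝒵 κ κ' → 𝒪 → ℝ) :
    E.codeMean w s (fun C o => Φ C o + Ψ C o) = E.codeMean w s Φ + E.codeMean w s Ψ := by
  simp only [codeMean, mul_add, Finset.sum_add_distrib]

open Classical in
theorem codeMean_sum {α : Type*} [Fintype α] (w : 𝓦) (s : ∀ i, κ i)
    (Φ : α → Codebook 𝒯 𝒳 𝓦 𝒳r 𝒵 κ κ' → 𝒪 → ℝ) :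
    E.codeMean w s (fun C o => ∑ a, Φ a C o) = ∑ a, E.codeMean w s (Φ a) := by
  simp only [codeMean, Finset.mul_sum]
  refine (Finset.sum_congr rfl fun C _ => Finset.sum_comm).trans ?_
  rw [Finset.sum_comm]

theorem codeMean_transmitted [∀ i, Nonempty (κ' i)] (w : 𝓦) (s : ∀ i, κ i)
    (Φ : 𝒯 → 𝒳 → (∀ i, 𝒳r i) → 𝒪 → ℝ) :
    E.codeMean w s (fun (C : Codebook 𝒯 𝒳 𝓦 𝒳r 𝒵 κ κ') o =>
      Φ C.1 (C.2.1 w) (fun i => C.2.2.1 i (s i)) o) = E.mean Φ := by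
  classical
  have := E.sum_weight_transmitted (κ' := κ') w s (fun T x xs => ∑ o, E.V x xs o * Φ T x xs o)
  unfold codeMean mean
  convert this

open Classical in
/-- The codeword of a wrong index is independent of the output, so its score averages to at most `1`
and each wrong index has a score `≥ a` with probability at most `1 / a`. -/
theorem codeMean_wrong_index_le [∀ i, Nonempty (κ' i)] (w : 𝓦) (s : ∀ i, κ i) (i : ι) {a : ℝ}
    (ha : 0 < a) :
    E.codeMean w s (fun (C : Codebook 𝒯 𝒳 𝓦 𝒳r 𝒵 κ κ') o =>
      ∑ k, iverson (k ≠ s i ∧ a ≤ E.f i (C.2.2.1 i k) (E.yOf o))) ≤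
      (Fintype.card (κ i) - 1) / a := by
  rw [codeMean_sum]
  have key : ∀ k, E.codeMean w s (fun (C : Codebook 𝒯 𝒳 𝓦 𝒳r 𝒵 κ κ') o =>
      iverson (k ≠ s i ∧ a ≤ E.f i (C.2.2.1 i k) (E.yOf o))) ≤ if k = s i then 0 else 1 / a := by
    intro k
    split_ifs with hk
    · refine le_of_eq (Finset.sum_eq_zero fun C _ => ?_)
      rw [Finset.sum_eq_zero, mul_zero]
      intro o _
      beta_reduce
      rw [iverson_false (fun h => h.1 hk), mul_zero]
    · unfold codeMean
      rw [E.sum_weight_resample_relay i k]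
      refine E.sum_weight_mul_le fun C => ?_
      -- The resampled codeword is not the transmitted one.
      have hs : ∀ b, (fun j => Function.update C.2.2.1 i (Function.update (C.2.2.1 i) k b) j (s j))
          = fun j => C.2.2.1 j (s j) := by
        intro b; ext j
        by_cases hj : j = i
        · subst hj; rw [Function.update_self, Function.update_of_ne (Ne.symm hk)]
        · rw [Function.update_of_ne hj]
      simp only [hs, Function.update_self, Finset.mul_sum]
      rw [Finset.sum_comm]
      have : ∀ o, ∑ b, E.pR i b * (E.V (C.2.1 w) (fun j => C.2.2.1 j (s j)) o *
          iverson (k ≠ s i ∧ a ≤ E.f i b (E.yOf o))) = E.V (C.2.1 w) (fun j => C.2.2.1 j (s j)) o *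
          ∑ b, E.pR i b * iverson (k ≠ s i ∧ a ≤ E.f i b (E.yOf o)) := by
        intro o; rw [Finset.mul_sum]; exact Finset.sum_congr rfl fun b _ => by ring
      simp only [this]
      refine E.sum_V_mul_le fun o => ?_
      calc ∑ b, E.pR i b * iverson (k ≠ s i ∧ a ≤ E.f i b (E.yOf o))
          ≤ ∑ b, E.pR i b * (E.f i b (E.yOf o) / a) :=
            Finset.sum_le_sum fun b _ => mul_le_mul_of_nonneg_left
              ((iverson_mono And.right).trans (iverson_le_div ha (E.f_nonneg _ _ _)))
              (E.pR_nonneg _ _)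
        _ = (∑ b, E.pR i b * E.f i b (E.yOf o)) / a := by
            rw [Finset.sum_div]; exact Finset.sum_congr rfl fun b _ => by ring
        _ ≤ 1 / a := by gcongr; exact E.f_sum i _
  refine (Finset.sum_le_sum fun k _ => key k).trans (le_of_eq ?_)
  rw [← Finset.add_sum_erase _ _ (Finset.mem_univ (s i)), if_pos rfl, zero_add,
    Finset.sum_congr rfl (fun k hk => if_neg (Finset.ne_of_mem_erase hk)), Finset.sum_const,
    Finset.card_erase_of_mem (Finset.mem_univ _), Finset.card_univ, nsmul_eq_mul,
    Nat.cast_sub (Fintype.card_pos_iff.2 ⟨s i⟩)]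
  push_cast; ring

open Classical in
/-- The analogue of `codeMean_wrong_index_le` for the codewords of the source. -/
theorem codeMean_wrong_message_le [∀ i, Nonempty (κ' i)] (w : 𝓦) (s : ∀ i, κ i) {a : ℝ}
    (ha : 0 < a) :
    E.codeMean w s (fun (C : Codebook 𝒯 𝒳 𝓦 𝒳r 𝒵 κ κ') o =>
      ∑ v, iverson (v ≠ w ∧ a ≤ E.φ C.1 (fun i => C.2.2.1 i (s i)) (E.yOf o) (E.zOf C.1 o)
        (C.2.1 v))) ≤
      (Fintype.card 𝓦 - 1) / a := by
  rw [codeMean_sum]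
  have key : ∀ v, E.codeMean w s (fun (C : Codebook 𝒯 𝒳 𝓦 𝒳r 𝒵 κ κ') o =>
      iverson (v ≠ w ∧ a ≤ E.φ C.1 (fun i => C.2.2.1 i (s i)) (E.yOf o) (E.zOf C.1 o)
        (C.2.1 v))) ≤ if v = w then 0 else 1 / a := by
    intro v
    split_ifs with hv
    · refine le_of_eq (Finset.sum_eq_zero fun C _ => ?_)
      rw [Finset.sum_eq_zero, mul_zero]
      intro o _
      beta_reduce
      rw [iverson_false (fun h => h.1 hv), mul_zero]
    · unfold codeMean
      rw [E.sum_weight_resample_message v]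
      refine E.sum_weight_mul_le fun C => ?_
      simp only [Function.update_of_ne (Ne.symm hv), Function.update_self, Finset.mul_sum]
      rw [Finset.sum_comm]
      have : ∀ o, ∑ b, E.pX b * (E.V (C.2.1 w) (fun j => C.2.2.1 j (s j)) o *
          iverson (v ≠ w ∧ a ≤ E.φ C.1 (fun i => C.2.2.1 i (s i)) (E.yOf o) (E.zOf C.1 o) b)) =
          E.V (C.2.1 w) (fun j => C.2.2.1 j (s j)) o * ∑ b, E.pX b *
          iverson (v ≠ w ∧ a ≤ E.φ C.1 (fun i => C.2.2.1 i (s i)) (E.yOf o) (E.zOf C.1 o) b) := by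
        intro o; rw [Finset.mul_sum]; exact Finset.sum_congr rfl fun b _ => by ring
      simp only [this]
      refine E.sum_V_mul_le fun o => ?_
      calc ∑ b, E.pX b *
            iverson (v ≠ w ∧ a ≤ E.φ C.1 (fun i => C.2.2.1 i (s i)) (E.yOf o) (E.zOf C.1 o) b)
          ≤ ∑ b, E.pX b *
            (E.φ C.1 (fun i => C.2.2.1 i (s i)) (E.yOf o) (E.zOf C.1 o) b / a) :=
            Finset.sum_le_sum fun b _ => mul_le_mul_of_nonneg_left
              ((iverson_mono And.right).trans (iverson_le_div ha (E.φ_nonneg _ _ _ _ _)))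
              (E.pX_nonneg _)
        _ = (∑ b, E.pX b *
            E.φ C.1 (fun i => C.2.2.1 i (s i)) (E.yOf o) (E.zOf C.1 o) b) / a := by
            rw [Finset.sum_div]; exact Finset.sum_congr rfl fun b _ => by ring
        _ ≤ 1 / a := by gcongr; exact E.φ_sum _ _ _ _
  refine (Finset.sum_le_sum fun v _ => key v).trans (le_of_eq ?_)
  rw [← Finset.add_sum_erase _ _ (Finset.mem_univ w), if_pos rfl, zero_add,
    Finset.sum_congr rfl (fun k hk => if_neg (Finset.ne_of_mem_erase hk)), Finset.sum_const,
    Finset.card_erase_of_mem (Finset.mem_univ _), Finset.card_univ, nsmul_eq_mul,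
    Nat.cast_sub (Fintype.card_pos_iff.2 ⟨w⟩)]
  push_cast; ring

open Classical in
/-- At most `G` reports have score at least `G⁻¹`, so at most `G - 1` wrong ones if the true
report is among them; each of these has the hash of the true one with probability `1 / card`. -/
theorem codeMean_wrong_report_le [∀ i, Nonempty (κ' i)] (w : 𝓦) (s : ∀ i, κ i) (i : ι) {a : ℝ}
    (ha : 1 ≤ a) :
    E.codeMean w s (fun (C : Codebook 𝒯 𝒳 𝓦 𝒳r 𝒵 κ κ') o =>
      ∑ z, iverson ((z ≠ E.zOf C.1 o i ∧
        a⁻¹ ≤ E.g i C.1 (fun i => C.2.2.1 i (s i)) (E.yOf o) (E.zOf C.1 o i) ∧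
        a⁻¹ ≤ E.g i C.1 (fun i => C.2.2.1 i (s i)) (E.yOf o) z) ∧
        C.2.2.2 i z = C.2.2.2 i (E.zOf C.1 o i))) ≤
      (a - 1) / Fintype.card (κ' i) := by
  rw [codeMean_sum]
  set P : Codebook 𝒯 𝒳 𝓦 𝒳r 𝒵 κ κ' → 𝒪 → 𝒵 i → Prop := fun C o z => z ≠ E.zOf C.1 o i ∧
        a⁻¹ ≤ E.g i C.1 (fun i => C.2.2.1 i (s i)) (E.yOf o) (E.zOf C.1 o i) ∧
        a⁻¹ ≤ E.g i C.1 (fun i => C.2.2.1 i (s i)) (E.yOf o) z with hP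
  have ha0 : 0 < a := by linarith
  have key : ∀ z, E.codeMean w s (fun C o => iverson (P C o z ∧
        C.2.2.2 i z = C.2.2.2 i (E.zOf C.1 o i))) =
      E.codeMean w s (fun C o => iverson (P C o z) * (Fintype.card (κ' i) : ℝ)⁻¹) := by
    intro z
    unfold codeMean
    rw [E.sum_weight_resample_hash i z]
    refine Finset.sum_congr rfl fun C _ => ?_
    congr 1
    simp only [Finset.mul_sum]
    rw [Finset.sum_comm]
    refine Finset.sum_congr rfl fun o _ => ?_
    by_cases hz : P C o z
    · have h1 : ∀ b : κ' i, iverson (P C o z ∧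
          Function.update C.2.2.2 i (Function.update (C.2.2.2 i) z b) i z =
          Function.update C.2.2.2 i (Function.update (C.2.2.2 i) z b) i (E.zOf C.1 o i)) =
          if b = C.2.2.2 i (E.zOf C.1 o i) then 1 else 0 := by
        intro b
        rw [Function.update_self, Function.update_self, Function.update_of_ne hz.1.symm]
        by_cases hb : b = C.2.2.2 i (E.zOf C.1 o i)
        · rw [iverson_true ⟨hz, hb⟩, if_pos hb]
        · rw [iverson_false (fun h => hb h.2), if_neg hb]
      have h2 : ∀ b : κ' i, P (C.1, C.2.1, C.2.2.1,
          Function.update C.2.2.2 i (Function.update (C.2.2.2 i) z b)) o z = P C o z :=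
        fun b => rfl
      simp only [h2, h1, iverson_true hz]
      simp
      ring
    · rw [iverson_false hz]
      simp only [zero_mul, mul_zero]
      refine Finset.sum_eq_zero fun b _ => ?_
      rw [iverson_false (fun h => hz h.1), mul_zero, mul_zero]
  refine (Finset.sum_congr rfl fun z _ => key z).trans_le ?_
  rw [← codeMean_sum]
  refine E.sum_weight_mul_le fun C => E.sum_V_mul_le fun o => ?_
  beta_reduce
  rw [← Finset.sum_mul, div_eq_mul_inv]
  refine mul_le_mul_of_nonneg_right ?_ (by positivity)
  set z₀ := E.zOf C.1 o i
  set γ := E.g i C.1 (fun i => C.2.2.1 i (s i)) (E.yOf o) with hγ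
  by_cases h0 : a⁻¹ ≤ γ z₀
  · have h1 : ∑ z, iverson (a⁻¹ ≤ γ z) ≤ a := by
      calc ∑ z, iverson (a⁻¹ ≤ γ z) ≤ ∑ z, γ z / a⁻¹ :=
            Finset.sum_le_sum fun z _ => iverson_le_div (by positivity) (E.g_nonneg _ _ _ _ _)
        _ = (∑ z, γ z) * a := by rw [← Finset.sum_div, div_inv_eq_mul]
        _ ≤ 1 * a := by gcongr; exact E.g_sum _ _ _ _
        _ = a := one_mul a
    rw [← Finset.add_sum_erase _ _ (Finset.mem_univ z₀), iverson_true h0] at h1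
    rw [← Finset.add_sum_erase _ _ (Finset.mem_univ z₀), iverson_false (fun h => h.1 rfl),
      zero_add]
    have h2 : ∑ z ∈ Finset.univ.erase z₀, iverson (P C o z) ≤
        ∑ z ∈ Finset.univ.erase z₀, iverson (a⁻¹ ≤ γ z) :=
      Finset.sum_le_sum fun z _ => iverson_mono fun h => h.2.2
    linarith
  · rw [Finset.sum_eq_zero fun z _ => iverson_false fun h => h0 h.2.1]
    linarith

/-- The bound on the probability of a decoding error, for thresholds `A`, `G`, `F` on the scores,
`M` messages, and `K i` indices and `K' i` hash values for relay `i`. -/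
def errorBound (A G : ι → ℝ) (F : ℝ) (K K' : ι → ℕ) (M : ℕ) : ℝ :=
  ∑ i, (E.mean (fun _ _ xs o => iverson (E.f i (xs i) (E.yOf o) < A i)) + (K i - 1) / A i) +
  ∑ i, (E.mean (fun T _ xs o => iverson (E.g i T xs (E.yOf o) (E.zOf T o i) < (G i)⁻¹)) +
    (G i - 1) / K' i) +
  (E.mean (fun T x xs o => iverson (E.φ T xs (E.yOf o) (E.zOf T o) x < F)) + (M - 1) / F)

theorem codeMean_failure_le [Nonempty 𝓦] [∀ i, Nonempty (κ i)] [∀ i, Nonempty (κ' i)]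
    [∀ i, Nonempty (𝒵 i)] {A G : ι → ℝ} {F : ℝ} (hA : ∀ i, 0 < A i) (hG : ∀ i, 1 ≤ G i)
    (hF : 0 < F) (w : 𝓦) (s : ∀ i, κ i) :
    E.codeMean w s (fun (C : Codebook 𝒯 𝒳 𝓦 𝒳r 𝒵 κ κ') o =>
      iverson (E.decodeIndex A C (E.yOf o) ≠ s ∨
        E.decodeMessage G F C (E.yOf o) s (fun i => C.2.2.2 i (E.zOf C.1 o i)) ≠ w)) ≤
    E.errorBound A G F (fun i => Fintype.card (κ i)) (fun i => Fintype.card (κ' i))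
      (Fintype.card 𝓦) := by
  have hsplit := fun (C : Codebook 𝒯 𝒳 𝓦 𝒳r 𝒵 κ κ') o =>
    iverson_mono (E.decoding_failure (A := A) (G := G) (F := F) (C := C) (w := w) (s := s) (o := o))
  refine (E.codeMean_mono w s (fun C o => (hsplit C o).trans
    ((iverson_or_le _ _).trans (add_le_add (iverson_exists_le _)
    ((iverson_or_le _ _).trans (add_le_add ((iverson_exists_le _).trans
      (Finset.sum_le_sum fun i _ => iverson_exists_le _))
    ((iverson_or_le _ _).trans (add_le_add (iverson_exists_le _)
    ((iverson_or_le _ _).trans (add_le_add ((iverson_exists_le _).trans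
      (Finset.sum_le_sum fun i _ => iverson_exists_le _))
    ((iverson_or_le _ _).trans (add_le_add le_rfl (iverson_exists_le _))))))))))))).trans ?_
  simp only [codeMean_add]
  rw [E.codeMean_sum w s (fun i (C : Codebook 𝒯 𝒳 𝓦 𝒳r 𝒵 κ κ') o =>
      iverson (E.f i (C.2.2.1 i (s i)) (E.yOf o) < A i)),
    E.codeMean_sum w s (fun i (C : Codebook 𝒯 𝒳 𝓦 𝒳r 𝒵 κ κ') o =>
      ∑ k, iverson (k ≠ s i ∧ A i ≤ E.f i (C.2.2.1 i k) (E.yOf o))),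
    E.codeMean_sum w s (fun i (C : Codebook 𝒯 𝒳 𝓦 𝒳r 𝒵 κ κ') o => iverson (E.g i C.1
      (fun i => C.2.2.1 i (s i)) (E.yOf o) (E.zOf C.1 o i) < (G i)⁻¹)),
    E.codeMean_sum w s (fun i (C : Codebook 𝒯 𝒳 𝓦 𝒳r 𝒵 κ κ') o =>
      ∑ z, iverson ((z ≠ E.zOf C.1 o i ∧
        (G i)⁻¹ ≤ E.g i C.1 (fun i => C.2.2.1 i (s i)) (E.yOf o) (E.zOf C.1 o i) ∧
        (G i)⁻¹ ≤ E.g i C.1 (fun i => C.2.2.1 i (s i)) (E.yOf o) z) ∧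
        C.2.2.2 i z = C.2.2.2 i (E.zOf C.1 o i)))]
  have e1 := Finset.sum_congr rfl fun i (_ : i ∈ Finset.univ) =>
    E.codeMean_transmitted (κ' := κ') w s
    (fun _ _ xs o => iverson (E.f i (xs i) (E.yOf o) < A i))
  have e2 := Finset.sum_congr rfl fun i (_ : i ∈ Finset.univ) =>
    E.codeMean_transmitted (κ' := κ') w s
    (fun T _ xs o => iverson (E.g i T xs (E.yOf o) (E.zOf T o i) < (G i)⁻¹))
  have e3 := E.codeMean_transmitted (κ' := κ') w s
    (fun T x xs o => iverson (E.φ T xs (E.yOf o) (E.zOf T o) x < F))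
  have b1 := Finset.sum_le_sum fun i (_ : i ∈ Finset.univ) =>
    E.codeMean_wrong_index_le (κ' := κ') w s i (hA i)
  have b2 := Finset.sum_le_sum fun i (_ : i ∈ Finset.univ) =>
    E.codeMean_wrong_report_le (κ' := κ') w s i (hG i)
  have b3 := E.codeMean_wrong_message_le (κ' := κ') w s hF
  unfold errorBound
  simp only [Finset.sum_add_distrib] at *
  linarith

/-- For any law `μ` of the transmitted message and indices there is a good codebook. -/
theorem exists_codebook [Nonempty 𝓦] [∀ i, Nonempty (κ i)] [∀ i, Nonempty (κ' i)]
    [∀ i, Nonempty (𝒵 i)] {A G : ι → ℝ} {F : ℝ} (hA : ∀ i, 0 < A i) (hG : ∀ i, 1 ≤ G i)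
    (hF : 0 < F) {Ω : Type*} [Fintype Ω] {μ : Ω → ℝ} (hμ : ∀ ω, 0 ≤ μ ω) (w : Ω → 𝓦)
    (s : Ω → ∀ i, κ i) :
    ∃ C : Codebook 𝒯 𝒳 𝓦 𝒳r 𝒵 κ κ',
      ∑ ω, μ ω * ∑ o, E.V (C.2.1 (w ω)) (fun i => C.2.2.1 i (s ω i)) o *
        iverson (E.decodeIndex A C (E.yOf o) ≠ s ω ∨
          E.decodeMessage G F C (E.yOf o) (s ω) (fun i => C.2.2.2 i (E.zOf C.1 o i)) ≠ w ω) ≤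
      (∑ ω, μ ω) * E.errorBound A G F (fun i => Fintype.card (κ i))
        (fun i => Fintype.card (κ' i)) (Fintype.card 𝓦) := by
  classical
  refine exists_le_of_sum_mul_le (w := E.weight) E.weight_nonneg E.weight_sum ?_
  simp only [Finset.mul_sum (s := (Finset.univ : Finset Ω))]
  rw [Finset.sum_comm, Finset.sum_mul]
  refine Finset.sum_le_sum fun ω _ => ?_
  refine le_trans (le_of_eq ?_) (mul_le_mul_of_nonneg_left
    (E.codeMean_failure_le (κ' := κ') hA hG hF (w ω) (s ω)) (hμ ω))
  unfold codeMean
  rw [Finset.mul_sum]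
  refine Finset.sum_congr (by congr!) fun C _ => by ring

end

end Experiment

/-! ### The weak law of large numbers for finite probability spaces -/

theorem sum_prod_mul_sum_eq_zero {Ω : Type*} [Fintype Ω] {p φ : Ω → ℝ}
    (hp : ∑ ω, p ω = 1) (hφ : ∑ ω, p ω * φ ω = 0) (m : ℕ) :
    ∑ ω : Fin m → Ω, (∏ t, p (ω t)) * ∑ t, φ (ω t) = 0 := by
  induction m with
  | zero => simp
  | succ m ih =>
    rw [← (Fin.consEquiv fun _ => Ω).sum_comp, Fintype.sum_prod_type]
    simp only [Fin.consEquiv, Equiv.coe_fn_mk, Fin.prod_univ_succ, Fin.cons_zero, Fin.cons_succ,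
      Fin.sum_univ_succ]
    have h1 : ∑ ω : Fin m → Ω, ∏ t, p (ω t) = 1 := by
      rw [sum_pi_prod (fun _ => p)]; simp [hp]
    have : ∀ a : Ω, ∑ ω : Fin m → Ω, p a * (∏ t, p (ω t)) * (φ a + ∑ t, φ (ω t)) = p a * φ a := by
      intro a
      calc _ = p a * φ a * ∑ ω : Fin m → Ω, (∏ t, p (ω t)) +
            p a * ∑ ω : Fin m → Ω, (∏ t, p (ω t)) * ∑ t, φ (ω t) := by
            rw [Finset.mul_sum, Finset.mul_sum, ← Finset.sum_add_distrib]
            exact Finset.sum_congr rfl fun ω _ => by ring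
        _ = p a * φ a := by rw [h1, ih]; ring
    simp only [this, hφ]

theorem sum_prod_mul_sum_sq {Ω : Type*} [Fintype Ω] {p φ : Ω → ℝ}
    (hp : ∑ ω, p ω = 1) (hφ : ∑ ω, p ω * φ ω = 0) (m : ℕ) :
    ∑ ω : Fin m → Ω, (∏ t, p (ω t)) * (∑ t, φ (ω t)) ^ 2 = m * ∑ ω, p ω * φ ω ^ 2 := by
  induction m with
  | zero => simp
  | succ m ih =>
    rw [← (Fin.consEquiv fun _ => Ω).sum_comp, Fintype.sum_prod_type]
    simp only [Fin.consEquiv, Equiv.coe_fn_mk, Fin.prod_univ_succ, Fin.cons_zero, Fin.cons_succ,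
      Fin.sum_univ_succ]
    have h1 : ∑ ω : Fin m → Ω, ∏ t, p (ω t) = 1 := by
      rw [sum_pi_prod (fun _ => p)]; simp [hp]
    have : ∀ a : Ω, ∑ ω : Fin m → Ω, p a * (∏ t, p (ω t)) * (φ a + ∑ t, φ (ω t)) ^ 2 =
        p a * φ a ^ 2 + p a * (m * ∑ ω, p ω * φ ω ^ 2) := by
      intro a
      calc _ = p a * φ a ^ 2 * ∑ ω : Fin m → Ω, (∏ t, p (ω t)) +
            2 * (p a * φ a) * (∑ ω : Fin m → Ω, (∏ t, p (ω t)) * ∑ t, φ (ω t)) +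
            p a * ∑ ω : Fin m → Ω, (∏ t, p (ω t)) * (∑ t, φ (ω t)) ^ 2 := by
            rw [Finset.mul_sum, Finset.mul_sum, Finset.mul_sum, ← Finset.sum_add_distrib,
              ← Finset.sum_add_distrib]
            exact Finset.sum_congr rfl fun ω _ => by ring
        _ = _ := by rw [h1, ih, sum_prod_mul_sum_eq_zero hp hφ]; ring
    simp only [this, Finset.sum_add_distrib, ← Finset.sum_mul, hp]
    push_cast; ring

/-- Chebyshev's inequality for the lower tail of a sum of independent copies of `φ`. -/
theorem sum_prod_mul_iverson_lt_le {Ω : Type*} [Fintype Ω] {p : Ω → ℝ} (φ : Ω → ℝ)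
    (hp0 : ∀ ω, 0 ≤ p ω) (hp : ∑ ω, p ω = 1) {m : ℕ} (hm : 0 < m) {r : ℝ}
    (hr : r < ∑ ω, p ω * φ ω) :
    ∑ ω : Fin m → Ω, (∏ t, p (ω t)) * iverson (∑ t, φ (ω t) < m * r) ≤
      ((∑ ω, p ω * (φ ω - ∑ ω', p ω' * φ ω') ^ 2) / (∑ ω', p ω' * φ ω' - r) ^ 2) / m := by
  set e := ∑ ω', p ω' * φ ω' with he
  have h0 : ∑ ω, p ω * (φ ω - e) = 0 := by
    simp only [mul_sub, Finset.sum_sub_distrib, ← Finset.sum_mul, hp]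
    rw [one_mul, ← he, sub_self]
  have h2 := sum_prod_mul_sum_sq hp h0 m
  have hm' : (0 : ℝ) < m := by exact_mod_cast hm
  have hd : 0 < e - r := by linarith
  calc ∑ ω : Fin m → Ω, (∏ t, p (ω t)) * iverson (∑ t, φ (ω t) < m * r)
      ≤ ∑ ω : Fin m → Ω, (∏ t, p (ω t)) * ((∑ t, (φ (ω t) - e)) ^ 2 / (m * (e - r)) ^ 2) := by
        refine Finset.sum_le_sum fun ω _ => mul_le_mul_of_nonneg_left ?_
          (Finset.prod_nonneg fun t _ => hp0 _)
        refine le_trans (iverson_mono fun h => ?_) (iverson_le_div (by positivity) (sq_nonneg _))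
        rw [Finset.sum_sub_distrib, Finset.sum_const, Finset.card_univ, Fintype.card_fin,
          nsmul_eq_mul, ← neg_sq (∑ t, φ (ω t) - m * e)]
        exact pow_le_pow_left₀ (by positivity) (by linarith) 2
    _ = (∑ ω : Fin m → Ω, (∏ t, p (ω t)) * (∑ t, (φ (ω t) - e)) ^ 2) / (m * (e - r)) ^ 2 := by
        rw [Finset.sum_div]; exact Finset.sum_congr rfl fun ω _ => by ring
    _ = _ := by rw [h2]; field_simp

/-- If `f > 0` almost surely, a product of `m` independent copies of `f` exceeds `2 ^ (m r)` with
high probability for every `r` less than the expectation of `log₂ f`. -/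
theorem tendsto_sum_prod_mul_iverson_prod_lt {Ω : Type*} [Fintype Ω] {p f : Ω → ℝ}
    (hp0 : ∀ ω, 0 ≤ p ω) (hp : ∑ ω, p ω = 1) (hf : ∀ ω, 0 < p ω → 0 < f ω) {r : ℝ}
    (hr : r < ∑ ω, p ω * Real.logb 2 (f ω)) :
    Tendsto (fun m : ℕ => ∑ ω : Fin m → Ω, (∏ t, p (ω t)) *
      iverson (∏ t, f (ω t) < (2 : ℝ) ^ ((m : ℝ) * r))) atTop (𝓝 0) := by
  set φ := fun ω => Real.logb 2 (f ω)
  refine squeeze_zero' (Eventually.of_forall fun m => Finset.sum_nonneg fun ω _ =>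
    mul_nonneg (Finset.prod_nonneg fun t _ => hp0 _) (iverson_nonneg _))
    (g := fun m : ℕ => ((∑ ω, p ω * (φ ω - ∑ ω', p ω' * φ ω') ^ 2) /
      (∑ ω', p ω' * φ ω' - r) ^ 2) / (m : ℝ)) ?_ (tendsto_const_div_atTop_nhds_zero_nat _)
  filter_upwards [eventually_gt_atTop 0] with m hm
  refine le_trans (Finset.sum_le_sum fun ω _ => ?_)
    (sum_prod_mul_iverson_lt_le φ hp0 hp hm hr)
  by_cases h0 : ∀ t, 0 < p (ω t)
  · refine mul_le_mul_of_nonneg_left (iverson_mono fun h => ?_)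
      (Finset.prod_nonneg fun t _ => hp0 _)
    have hpos : ∀ t, 0 < f (ω t) := fun t => hf _ (h0 t)
    have h1 : ∏ t, f (ω t) = (2 : ℝ) ^ (∑ t, φ (ω t)) := by
      rw [Real.rpow_sum_of_pos two_pos]
      exact Finset.prod_congr rfl fun t _ =>
        (Real.rpow_logb two_pos (by norm_num) (hpos t)).symm
    rw [h1] at h
    exact (Real.rpow_lt_rpow_left_iff (by norm_num)).1 h
  · push Not at h0
    obtain ⟨t, ht⟩ := h0
    rw [Finset.prod_eq_zero (Finset.mem_univ t) (le_antisymm ht (hp0 _)), zero_mul, zero_mul]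

/-! ### Independent repetitions of an experiment -/

theorem sum_pi_prod_mul_le_one {J : Type*} [Fintype J] [DecidableEq J] {α : J → Type*}
    [∀ j, Fintype (α j)] (p f : ∀ j, α j → ℝ) (hp : ∀ j a, 0 ≤ p j a) (hf : ∀ j a, 0 ≤ f j a)
    (h : ∀ j, ∑ a, p j a * f j a ≤ 1) :
    ∑ c : ∀ j, α j, (∏ j, p j (c j)) * ∏ j, f j (c j) ≤ 1 := by
  simp only [← Finset.prod_mul_distrib]
  rw [sum_pi_prod (fun j a => p j a * f j a)]
  exact Finset.prod_le_one (fun j _ => Finset.sum_nonneg fun a _ => mul_nonneg (hp j a) (hf j a))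
    fun j _ => h j

namespace Experiment

variable {ι 𝒯 𝒳 𝒴 𝒪 : Type*} {𝒳r 𝒵 : ι → Type*} [Fintype ι] [Fintype 𝒯] [Fintype 𝒳]
  [Fintype 𝒪] [∀ i, Fintype (𝒳r i)] [∀ i, Fintype (𝒵 i)]
  (E : Experiment ι 𝒯 𝒳 𝒴 𝒪 𝒳r 𝒵)

/-- The experiment `E` repeated `m` times independently; the score of a word is the product of the
scores of its letters. -/
def pow (m : ℕ) : Experiment ι (Fin m → 𝒯) (Fin m → 𝒳) (Fin m → 𝒴) (Fin m → 𝒪)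
    (fun i => Fin m → 𝒳r i) (fun i => Fin m → 𝒵 i) where
  V x xs o := ∏ t, E.V (x t) (fun i => xs i t) (o t)
  V_nonneg x xs o := Finset.prod_nonneg fun t _ => E.V_nonneg _ _ _
  V_sum x xs := by
    rw [sum_pi_prod (fun t => E.V (x t) (fun i => xs i t))]
    exact Finset.prod_eq_one fun t _ => E.V_sum _ _
  yOf o t := E.yOf (o t)
  zOf T o i t := E.zOf (T t) (o t) i
  pT T := ∏ t, E.pT (T t)
  pT_nonneg T := Finset.prod_nonneg fun t _ => E.pT_nonneg _
  pT_sum := by rw [sum_pi_prod (fun _ => E.pT)]; simp [E.pT_sum]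
  pX x := ∏ t, E.pX (x t)
  pX_nonneg x := Finset.prod_nonneg fun t _ => E.pX_nonneg _
  pX_sum := by rw [sum_pi_prod (fun _ => E.pX)]; simp [E.pX_sum]
  pR i x := ∏ t, E.pR i (x t)
  pR_nonneg i x := Finset.prod_nonneg fun t _ => E.pR_nonneg _ _
  pR_sum i := by rw [sum_pi_prod (fun _ => E.pR i)]; simp [E.pR_sum]
  f i x y := ∏ t, E.f i (x t) (y t)
  f_nonneg i x y := Finset.prod_nonneg fun t _ => E.f_nonneg _ _ _
  f_sum i y := sum_pi_prod_mul_le_one (fun _ => E.pR i) (fun t x => E.f i x (y t))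
    (fun _ => E.pR_nonneg i) (fun t x => E.f_nonneg i x _) fun t => E.f_sum i _
  g i T xs y z := ∏ t, E.g i (T t) (fun j => xs j t) (y t) (z t)
  g_nonneg i T xs y z := Finset.prod_nonneg fun t _ => E.g_nonneg _ _ _ _ _
  g_sum i T xs y := by
    rw [sum_pi_prod (fun t => E.g i (T t) (fun j => xs j t) (y t))]
    exact Finset.prod_le_one (fun t _ => Finset.sum_nonneg fun z _ => E.g_nonneg _ _ _ _ _)
      fun t _ => E.g_sum _ _ _ _
  φ T xs y z x := ∏ t, E.φ (T t) (fun j => xs j t) (y t) (fun i => z i t) (x t)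
  φ_nonneg T xs y z x := Finset.prod_nonneg fun t _ => E.φ_nonneg _ _ _ _ _
  φ_sum T xs y z := sum_pi_prod_mul_le_one (fun _ => E.pX)
    (fun t x => E.φ (T t) (fun j => xs j t) (y t) (fun i => z i t) x)
    (fun _ => E.pX_nonneg) (fun t x => E.φ_nonneg _ _ _ _ _) fun t => E.φ_sum _ _ _ _

/-- The joint law of the common variable, the inputs and the output. -/
def letterLaw (ω : 𝒯 × 𝒳 × (∀ i, 𝒳r i) × 𝒪) : ℝ :=
  E.pT ω.1 * E.pX ω.2.1 * (∏ i, E.pR i (ω.2.2.1 i)) * E.V ω.2.1 ω.2.2.1 ω.2.2.2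

theorem letterLaw_nonneg (ω : 𝒯 × 𝒳 × (∀ i, 𝒳r i) × 𝒪) : 0 ≤ E.letterLaw ω :=
  mul_nonneg (mul_nonneg (mul_nonneg (E.pT_nonneg _) (E.pX_nonneg _))
    (Finset.prod_nonneg fun _ _ => E.pR_nonneg _ _)) (E.V_nonneg _ _ _)

variable [DecidableEq ι]

theorem letterLaw_sum : ∑ ω, E.letterLaw ω = 1 := by
  simp only [Fintype.sum_prod_type, letterLaw, ← Finset.mul_sum, E.V_sum, mul_one]
  rw [sum_pi_prod E.pR]
  simp [← Finset.mul_sum, E.pX_sum, E.pT_sum, E.pR_sum]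

theorem mean_pow (m : ℕ)
    (Φ : (Fin m → 𝒯) → (Fin m → 𝒳) → (∀ i, Fin m → 𝒳r i) → (Fin m → 𝒪) → ℝ) :
    (E.pow m).mean Φ = ∑ ω : Fin m → 𝒯 × 𝒳 × (∀ i, 𝒳r i) × 𝒪, (∏ t, E.letterLaw (ω t)) *
      Φ (fun t => (ω t).1) (fun t => (ω t).2.1) (fun i t => (ω t).2.2.1 i)
        (fun t => (ω t).2.2.2) := by
  let e : (Fin m → 𝒯 × 𝒳 × (∀ i, 𝒳r i) × 𝒪) ≃
      ((Fin m → 𝒯) × (Fin m → 𝒳) × (∀ i, Fin m → 𝒳r i)) × (Fin m → 𝒪) :=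
    { toFun := fun ω => ((fun t => (ω t).1, fun t => (ω t).2.1, fun i t => (ω t).2.2.1 i),
        fun t => (ω t).2.2.2)
      invFun := fun q t => (q.1.1 t, q.1.2.1 t, fun i => q.1.2.2 i t, q.2 t)
      left_inv := fun _ => rfl
      right_inv := fun _ => rfl }
  calc (E.pow m).mean Φ
      = ∑ q : ((Fin m → 𝒯) × (Fin m → 𝒳) × (∀ i, Fin m → 𝒳r i)) × (Fin m → 𝒪),
          (∏ t, E.pT (q.1.1 t)) * (∏ t, E.pX (q.1.2.1 t)) * (∏ i, ∏ t, E.pR i (q.1.2.2 i t)) *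
          ((∏ t, E.V (q.1.2.1 t) (fun i => q.1.2.2 i t) (q.2 t)) *
            Φ q.1.1 q.1.2.1 q.1.2.2 q.2) := by
        rw [Fintype.sum_prod_type]
        exact Finset.sum_congr rfl fun _ _ => Finset.mul_sum _ _ _
    _ = _ := by
        rw [← e.sum_comp]
        refine Finset.sum_congr rfl fun ω _ => ?_
        simp only [e, Equiv.coe_fn_mk, letterLaw, Finset.prod_mul_distrib]
        rw [Finset.prod_comm]
        ring

/-- The law of large numbers for the product of independent copies of a score `ψ`. -/
theorem tendsto_mean_pow_iverson_lt (ψ : 𝒯 → 𝒳 → (∀ i, 𝒳r i) → 𝒪 → ℝ)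
    (hψ : ∀ ω, 0 < E.letterLaw ω → 0 < ψ ω.1 ω.2.1 ω.2.2.1 ω.2.2.2) {r : ℝ}
    (hr : r < ∑ ω, E.letterLaw ω * Real.logb 2 (ψ ω.1 ω.2.1 ω.2.2.1 ω.2.2.2)) :
    Tendsto (fun m : ℕ => (E.pow m).mean fun T x xs o =>
      iverson (∏ t, ψ (T t) (x t) (fun i => xs i t) (o t) < (2 : ℝ) ^ ((m : ℝ) * r)))
      atTop (𝓝 0) := by
  have h := tendsto_sum_prod_mul_iverson_prod_lt (p := E.letterLaw)
    (f := fun ω => ψ ω.1 ω.2.1 ω.2.2.1 ω.2.2.2) E.letterLaw_nonneg E.letterLaw_sum hψ hr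
  refine h.congr fun m => ?_
  rw [mean_pow]

end Experiment

/-! ### Extending relay codes block by block -/

section Extension

variable {N : ℕ} {X Y : Type*} {XR YR : Fin N → Type*}

/-- The code `c` followed by `m` further channel uses, in which the source sends `x w` and relay
`i` sends a word that depends on its outputs during `c`. -/
def RelayCode.extend {n M : ℕ} (c : RelayCode X Y XR YR n M) {m : ℕ} (x : Fin M → Fin m → X)
    (r : ∀ i, (Fin n → YR i) → Fin m → XR i) : RelayCode X Y XR YR (n + m) M where
  enc w := Fin.append (c.enc w) (x w)
  relay i t past :=
    if h : (t : ℕ) < n then c.relay i ⟨t, h⟩ past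
    else r i (fun s => past ⟨s, s.isLt.trans_le (not_lt.1 h)⟩) ⟨t - n, by omega⟩
  dec y := c.dec fun t => y (Fin.castAdd m t)

theorem RelayCode.relayInput_extend_castAdd {n M m : ℕ} (c : RelayCode X Y XR YR n M)
    (x : Fin M → Fin m → X) (r : ∀ i, (Fin n → YR i) → Fin m → XR i)
    (ys : Fin n → ∀ i, YR i) (ys' : Fin m → ∀ i, YR i) (t : Fin n) :
    (c.extend x r).relayInput (Fin.append ys ys') (Fin.castAdd m t) = c.relayInput ys t := by
  ext i
  have h : ((Fin.castAdd m t : Fin (n + m)) : ℕ) < n := t.isLt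
  simp only [relayInput, extend]
  rw [dif_pos h]
  change c.relay i t _ = _
  congr 1
  ext s
  exact congrFun (Fin.append_left ys ys' (Fin.castLE t.isLt.le s)) i

theorem RelayCode.relayInput_extend_natAdd {n M m : ℕ} (c : RelayCode X Y XR YR n M)
    (x : Fin M → Fin m → X) (r : ∀ i, (Fin n → YR i) → Fin m → XR i)
    (ys : Fin n → ∀ i, YR i) (ys' : Fin m → ∀ i, YR i) (t : Fin m) :
    (c.extend x r).relayInput (Fin.append ys ys') (Fin.natAdd n t) =
      fun i => r i (fun s => ys s i) t := by
  ext i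
  have h : ¬ ((Fin.natAdd n t : Fin (n + m)) : ℕ) < n := by simp
  simp only [relayInput, extend]
  rw [dif_neg h]
  congr 1
  · ext s
    exact congrFun (Fin.append_left ys ys' s) i
  · ext; simp

variable [Fintype Y] [∀ i, Fintype (YR i)]
  (W : RelayChannel N X Y XR YR)

theorem RelayCode.blockProb_nonneg {n M : ℕ} (c : RelayCode X Y XR YR n M) (w : Fin M)
    (y : Fin n → Y) (ys : Fin n → ∀ i, YR i) : 0 ≤ c.blockProb W w y ys :=
  Finset.prod_nonneg fun _ _ => (W.prob_mem _ _).1 _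

theorem RelayCode.blockProb_extend {n M m : ℕ} (c : RelayCode X Y XR YR n M)
    (x : Fin M → Fin m → X) (r : ∀ i, (Fin n → YR i) → Fin m → XR i) (w : Fin M)
    (y : Fin n → Y) (ys : Fin n → ∀ i, YR i) (y' : Fin m → Y) (ys' : Fin m → ∀ i, YR i) :
    (c.extend x r).blockProb W w (Fin.append y y') (Fin.append ys ys') =
      c.blockProb W w y ys *
        ∏ t, W.prob (x w t) (fun i => r i (fun s => ys s i) t) (y' t, ys' t) := by
  unfold blockProb
  rw [Fin.prod_univ_add]
  simp only [relayInput_extend_castAdd, relayInput_extend_natAdd, Fin.append_left,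
    Fin.append_right]
  simp only [extend, Fin.append_left, Fin.append_right]

theorem RelayCode.sum_blockProb_extend {n M m : ℕ} (c : RelayCode X Y XR YR n M)
    (x : Fin M → Fin m → X) (r : ∀ i, (Fin n → YR i) → Fin m → XR i) (w : Fin M)
    (Φ : (Fin (n + m) → Y) → (Fin (n + m) → ∀ i, YR i) → ℝ) :
    ∑ y, ∑ ys, (c.extend x r).blockProb W w y ys * Φ y ys =
      ∑ y, ∑ ys, c.blockProb W w y ys * ∑ o : Fin m → Y × (∀ i, YR i),
        (∏ t, W.prob (x w t) (fun i => r i (fun s => ys s i) t) (o t)) *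
          Φ (Fin.append y fun t => (o t).1) (Fin.append ys fun t => (o t).2) := by
  rw [← (Fin.appendEquiv n m).sum_comp, Fintype.sum_prod_type]
  refine Finset.sum_congr rfl fun y _ => ?_
  have h : ∀ y' : Fin m → Y, ∑ ys, (c.extend x r).blockProb W w (Fin.append y y') ys *
      Φ (Fin.append y y') ys = ∑ ys, ∑ ys', c.blockProb W w y ys *
        ((∏ t, W.prob (x w t) (fun i => r i (fun s => ys s i) t) (y' t, ys' t)) *
        Φ (Fin.append y y') (Fin.append ys ys')) := by
    intro y'
    rw [← (Fin.appendEquiv n m).sum_comp, Fintype.sum_prod_type]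
    refine Finset.sum_congr rfl fun ys _ => Finset.sum_congr rfl fun ys' _ => ?_
    change (c.extend x r).blockProb W w (Fin.append y y') (Fin.append ys ys') *
      Φ (Fin.append y y') (Fin.append ys ys') = _
    rw [blockProb_extend, mul_assoc]
  refine (Finset.sum_congr rfl fun y' _ => h y').trans ?_
  rw [Finset.sum_comm]
  refine Finset.sum_congr rfl fun ys _ => ?_
  rw [Finset.mul_sum, ← (Equiv.arrowProdEquivProdArrow (Fin m) (fun _ => Y)
    (fun _ => ∀ i, YR i)).symm.sum_comp, Fintype.sum_prod_type]
  rfl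

theorem RelayChannel.sum_prod_prob {m : ℕ} (x : Fin m → X) (xs : Fin m → ∀ i, XR i) :
    ∑ o : Fin m → Y × (∀ i, YR i), ∏ t, W.prob (x t) (xs t) (o t) = 1 := by
  rw [sum_pi_prod (fun t => W.prob (x t) (xs t))]
  exact Finset.prod_eq_one fun t _ => (W.prob_mem _ _).2

theorem RelayCode.errorProb_eq {n M : ℕ} (c : RelayCode X Y XR YR n M) :
    c.errorProb W =
      (∑ w, ∑ y, ∑ ys, c.blockProb W w y ys * iverson (c.dec y ≠ w)) / M := by
  unfold errorProb
  congr 1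
  refine Finset.sum_congr rfl fun w _ => Finset.sum_congr rfl fun y _ =>
    Finset.sum_congr rfl fun ys _ => ?_
  split_ifs with h
  · rw [iverson_true h, mul_one]
  · rw [iverson_false h, mul_zero]

theorem RelayCode.errorProb_nonneg {n M : ℕ} (c : RelayCode X Y XR YR n M) :
    0 ≤ c.errorProb W := by
  rw [errorProb_eq]
  exact div_nonneg (Finset.sum_nonneg fun w _ => Finset.sum_nonneg fun y _ =>
    Finset.sum_nonneg fun ys _ => mul_nonneg (c.blockProb_nonneg W w y ys) (iverson_nonneg _))
    (Nat.cast_nonneg M)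

theorem RelayCode.errorProb_extend {n M m : ℕ} (c : RelayCode X Y XR YR n M)
    (x : Fin M → Fin m → X) (r : ∀ i, (Fin n → YR i) → Fin m → XR i) :
    (c.extend x r).errorProb W = c.errorProb W := by
  rw [errorProb_eq, errorProb_eq]
  congr 1
  refine Finset.sum_congr rfl fun w _ => ?_
  rw [sum_blockProb_extend W c x r w fun y _ => iverson ((c.extend x r).dec y ≠ w)]
  refine Finset.sum_congr rfl fun y _ => Finset.sum_congr rfl fun ys _ => ?_
  simp only [extend, Fin.append_left]
  rw [← Finset.sum_mul, W.sum_prod_prob, one_mul]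

/-- A code of length `n` for `b` blocks exists that has error probability at most `ε` when, after
the last channel use, the destination is told the hashes `h i` of the outputs of the relays. Message
`w` has the digits `u w 0, …, u w (b - 1)`; only the last digit may be decoded with the help of the
hashes. -/
def RelayChannel.AidedCode (κ : Fin N → Type*) {M M' : ℕ} (u : Fin M → ℕ → Fin M') (n b : ℕ)
    (ε : ℝ) : Prop :=
  ∃ (c : RelayCode X Y XR YR n M) (h : ∀ i, (Fin n → YR i) → κ i)
    (δ : (Fin n → Y) → (∀ i, κ i) → ℕ → Fin M'),
    (∀ y s s' j, j + 1 < b → δ y s j = δ y s' j) ∧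
    (∀ w, ∑ y, ∑ ys, c.blockProb W w y ys = 1) ∧
    ∑ w, ∑ y, ∑ ys, c.blockProb W w y ys *
      iverson (∃ j < b, δ y (fun i => h i fun t => ys t i) j ≠ u w j) ≤ M * ε

theorem RelayChannel.aidedCode_zero (κ : Fin N → Type*) [∀ i, Nonempty (κ i)] {M M' : ℕ}
    (u : Fin M → ℕ → Fin M') (hM : 0 < M) (hM' : 0 < M') : W.AidedCode κ u 0 0 0 := by
  refine ⟨⟨fun _ t => t.elim0, fun _ t => t.elim0, fun _ => ⟨0, hM⟩⟩,
    fun i _ => Classical.arbitrary _, fun _ _ _ => ⟨0, hM'⟩, fun _ _ _ _ _ => rfl, ?_, ?_⟩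
  · intro w; simp [RelayCode.blockProb]
  · simp [iverson_false]

/-- One more block: relay `i` sends the codeword of the hash of its previous outputs, the
destination decodes these hashes, uses them to complete the decoding of the previous digit, and is
left with the next digit, for which it needs the new hashes. -/
theorem RelayChannel.AidedCode.step [Fintype X] [∀ i, Fintype (XR i)]
    {W : RelayChannel N X Y XR YR} {κ : Fin N → Type*} [∀ i, Fintype (κ i)] [∀ i, Nonempty (κ i)]
    {M M' : ℕ} {u : Fin M → ℕ → Fin M'} {n b : ℕ} {ε : ℝ} (hc : W.AidedCode κ u n b ε)
    (hM' : 0 < M') {𝒯 : Type*} {𝒵 : Fin N → Type*} [Fintype 𝒯] [∀ i, Fintype (𝒵 i)]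
    [∀ i, Nonempty (𝒵 i)]
    (E : Experiment (Fin N) 𝒯 X Y (Y × (∀ i, YR i)) XR 𝒵) (hV : E.V = W.prob)
    (hy : ∀ o, E.yOf o = o.1) (ζ : ∀ i, 𝒯 → YR i → 𝒵 i)
    (hz : ∀ T o i, E.zOf T o i = ζ i T (o.2 i)) (m : ℕ)
    {A G : Fin N → ℝ} {F : ℝ} (hA : ∀ i, 0 < A i) (hG : ∀ i, 1 ≤ G i) (hF : 0 < F) :
    W.AidedCode κ u (n + m) (b + 1) (ε + (E.pow m).errorBound A G F (fun i => Fintype.card (κ i))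
      (fun i => Fintype.card (κ i)) M') := by
  obtain ⟨c, h, δ, hδ, h1, hε⟩ := hc
  have : Nonempty (Fin M') := ⟨⟨0, hM'⟩⟩
  obtain ⟨C, hC⟩ := (E.pow m).exists_codebook (κ := κ) (κ' := κ) hA hG hF
    (μ := fun ω : Fin M × (Fin n → Y) × (Fin n → ∀ i, YR i) => c.blockProb W ω.1 ω.2.1 ω.2.2)
    (fun ω => c.blockProb_nonneg W _ _ _) (fun ω => u ω.1 b)
    (fun ω i => h i fun t => ω.2.2 t i)
  have hpow : ∀ (x : Fin m → X) (xs : ∀ i, Fin m → XR i) (o : Fin m → Y × (∀ i, YR i)),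
      (E.pow m).V x xs o = ∏ t, W.prob (x t) (fun i => xs i t) (o t) := by
    intro x xs o
    rw [← hV]
    rfl
  have hyp : ∀ o : Fin m → Y × (∀ i, YR i), (E.pow m).yOf o = fun t => (o t).1 :=
    fun o => funext fun t => hy (o t)
  have hzp : ∀ T (o : Fin m → Y × (∀ i, YR i)) i,
      (E.pow m).zOf T o i = fun t => ζ i (T t) ((o t).2 i) :=
    fun T o i => funext fun t => hz (T t) (o t) i
  set eb := (E.pow m).errorBound A G F (fun i => Fintype.card (κ i))
      (fun i => Fintype.card (κ i)) M' with heb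
  refine ⟨c.extend (fun w => C.2.1 (u w b)) (fun i past => C.2.2.1 i (h i past)),
    fun i past => C.2.2.2 i fun t => ζ i (C.1 t) (past (Fin.natAdd n t)),
    fun y s j => if j < b then
        δ (fun t => y (Fin.castAdd m t))
          ((E.pow m).decodeIndex A C fun t => y (Fin.natAdd n t)) j
      else (E.pow m).decodeMessage G F C (fun t => y (Fin.natAdd n t))
        ((E.pow m).decodeIndex A C fun t => y (Fin.natAdd n t)) s, ?_, ?_, ?_⟩
  · intro y s s' j hj
    simp only [if_pos (Nat.lt_of_succ_lt_succ hj)]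
  · intro w
    have := RelayCode.sum_blockProb_extend W c (fun w => C.2.1 (u w b))
      (fun i past => C.2.2.1 i (h i past)) w (fun _ _ => 1)
    simp only [mul_one, W.sum_prod_prob, h1] at this
    exact this
  · have hμ : ∑ ω : Fin M × (Fin n → Y) × (Fin n → ∀ i, YR i),
        c.blockProb W ω.1 ω.2.1 ω.2.2 = M := by
      simp [Fintype.sum_prod_type, h1]
    rw [hμ, Fintype.card_fin] at hC
    rw [mul_add]
    refine le_trans ?_ (add_le_add hε hC)
    rw [Fintype.sum_prod_type, ← Finset.sum_add_distrib]
    refine Finset.sum_le_sum fun w _ => ?_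
    rw [RelayCode.sum_blockProb_extend W c (fun w => C.2.1 (u w b))
      (fun i past => C.2.2.1 i (h i past)) w (fun y ys => iverson (∃ j < b + 1, _ ≠ u w j)),
      Fintype.sum_prod_type, ← Finset.sum_add_distrib]
    refine Finset.sum_le_sum fun y _ => ?_
    rw [← Finset.sum_add_distrib]
    refine Finset.sum_le_sum fun ys _ => ?_
    rw [← mul_add]
    refine mul_le_mul_of_nonneg_left ?_ (c.blockProb_nonneg W _ _ _)
    simp only [hpow, hyp, hzp, Fin.append_left, Fin.append_right]
    set s : ∀ i, κ i := fun i => h i fun t => ys t i with hs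
    set old := iverson (∃ j < b, δ y s j ≠ u w j) with hold
    have hsum := W.sum_prod_prob (C.2.1 (u w b)) (fun t i => C.2.2.1 i (s i) t)
    rw [← one_mul old, ← hsum, Finset.sum_mul, ← Finset.sum_add_distrib]
    refine Finset.sum_le_sum fun o _ => ?_
    rw [← mul_add]
    refine mul_le_mul_of_nonneg_left (le_trans (iverson_mono ?_) (iverson_or_le _ _))
      (Finset.prod_nonneg fun _ _ => (W.prob_mem _ _).1 _)
    rintro ⟨j, hj, hne⟩
    by_contra! hcon
    obtain ⟨ho, hi, hm⟩ := hcon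
    apply hne
    rw [hi]
    split_ifs with hjb
    · exact ho j hjb
    · rw [show j = b by omega]
      exact hm

/-- Once the last digit is dropped, no hashes are needed, and constant inputs fill the remaining
`r` channel uses. -/
theorem RelayChannel.AidedCode.exists_relayCode {W : RelayChannel N X Y XR YR} {κ : Fin N → Type*}
    [∀ i, Nonempty (κ i)] [Nonempty X] [∀ i, Nonempty (XR i)]
    {M M' : ℕ} (hM : 0 < M) {u : Fin M → ℕ → Fin M'} {n B : ℕ} {ε : ℝ}
    (hu : ∀ w w', (∀ j < B, u w j = u w' j) → w = w')
    (hc : W.AidedCode κ u n (B + 1) ε) (r : ℕ) :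
    ∃ c : RelayCode X Y XR YR (n + r) M, c.errorProb W ≤ ε := by
  obtain ⟨c, h, δ, hδ, -, hε⟩ := hc
  have : Nonempty (Fin M) := ⟨⟨0, hM⟩⟩
  let c' : RelayCode X Y XR YR n M := { c with
    dec := fun y => Classical.epsilon fun w =>
      ∀ j < B, δ y (fun _ => Classical.arbitrary _) j = u w j }
  refine ⟨c'.extend (fun _ _ => Classical.arbitrary X)
    (fun i _ _ => Classical.arbitrary (XR i)), ?_⟩
  rw [RelayCode.errorProb_extend, RelayCode.errorProb_eq, div_le_iff₀ (by exact_mod_cast hM),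
    mul_comm ε]
  refine le_trans (Finset.sum_le_sum fun w _ => Finset.sum_le_sum fun y _ =>
    Finset.sum_le_sum fun ys _ => mul_le_mul_of_nonneg_left (iverson_mono fun hne => ?_)
      (c.blockProb_nonneg W w y ys)) hε
  by_contra! hcon
  refine hne (epsilon_eq_of_unique (fun j hj => ?_) fun w' hw' hd => hw' (hu w' w ?_))
  · rw [← hcon j (by omega)]
    exact hδ _ _ _ _ (by omega)
  · intro j hj
    rw [← hd j hj, ← hcon j (by omega)]
    exact hδ _ _ _ _ (by omega)

end Extension

/-! ### Laws, entropies and informations as averages -/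

section Law

variable {Ω α β γ : Type*} [Fintype Ω] {p : Ω → ℝ}

theorem law_eq_sum_iverson (p : Ω → ℝ) (f : Ω → α) (a : α) :
    law p f a = ∑ ω, p ω * iverson (f ω = a) := by
  unfold law
  refine Finset.sum_congr rfl fun ω _ => ?_
  split_ifs with h
  · rw [iverson_true h, mul_one]
  · rw [iverson_false h, mul_zero]

theorem law_nonneg (hp : ∀ ω, 0 ≤ p ω) (f : Ω → α) (a : α) : 0 ≤ law p f a := by
  rw [law_eq_sum_iverson]
  exact Finset.sum_nonneg fun ω _ => mul_nonneg (hp ω) (iverson_nonneg _)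

theorem law_pos (hp : ∀ ω, 0 ≤ p ω) (f : Ω → α) {ω : Ω} (h : 0 < p ω) : 0 < law p f (f ω) := by
  rw [law_eq_sum_iverson]
  refine Finset.sum_pos' (fun ω _ => mul_nonneg (hp ω) (iverson_nonneg _))
    ⟨ω, Finset.mem_univ ω, ?_⟩
  rwa [iverson_true rfl, mul_one]

theorem law_comp_injective {e : α → β} (he : Function.Injective e) (p : Ω → ℝ) (f : Ω → α)
    (a : α) : law p (fun ω => e (f ω)) (e a) = law p f a := by
  simp only [law_eq_sum_iverson, he.eq_iff]

theorem sum_law_mul [Fintype α] (p : Ω → ℝ) (f : Ω → α) (F : α → ℝ) :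
    ∑ a, law p f a * F a = ∑ ω, p ω * F (f ω) := by
  simp only [law_eq_sum_iverson, Finset.sum_mul]
  rw [Finset.sum_comm]
  refine Finset.sum_congr rfl fun ω _ => ?_
  rw [Finset.sum_eq_single (f ω)]
  · rw [iverson_true rfl, mul_one]
  · intro a _ ha
    rw [iverson_false (Ne.symm ha), mul_zero, zero_mul]
  · intro h; exact absurd (Finset.mem_univ _) h

theorem sum_law_prod_left [Fintype α] (p : Ω → ℝ) (f : Ω → α) (g : Ω → β) (b : β) :
    ∑ a, law p (fun ω => (f ω, g ω)) (a, b) = law p g b := by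
  simp only [law_eq_sum_iverson]
  rw [Finset.sum_comm]
  refine Finset.sum_congr rfl fun ω _ => ?_
  rw [Finset.sum_eq_single (f ω)]
  · simp
  · intro a _ ha
    rw [iverson_false (fun h => ha (Prod.ext_iff.1 h).1.symm), mul_zero]
  · intro h; exact absurd (Finset.mem_univ _) h

/-- `∑ₐ p(a | b) ≤ 1`, with equality unless `p(b) = 0`. -/
theorem sum_law_div_law_le_one [Fintype α] (p : Ω → ℝ) (f : Ω → α) (g : Ω → β) (b : β) :
    ∑ a, law p (fun ω => (f ω, g ω)) (a, b) / law p g b ≤ 1 := by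
  rw [← Finset.sum_div, sum_law_prod_left]
  exact div_self_le_one _

theorem sum_law_mul_div_le_one [Fintype α] (hp : ∀ ω, 0 ≤ p ω) (f : Ω → α) (g : Ω → β) (b : β) :
    ∑ a, law p f a * (law p (fun ω => (f ω, g ω)) (a, b) / (law p f a * law p g b)) ≤ 1 := by
  refine le_trans (Finset.sum_le_sum fun a _ => ?_) (sum_law_div_law_le_one p f g b)
  have h : 0 ≤ law p (fun ω => (f ω, g ω)) (a, b) / law p g b :=
    div_nonneg (law_nonneg hp _ _) (law_nonneg hp _ _)
  rcases eq_or_ne (law p f a) 0 with h0 | h0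
  · rw [h0, zero_mul]; exact h
  · exact le_of_eq (by field_simp)

theorem law_prod_le [Fintype α] (hp : ∀ ω, 0 ≤ p ω) (f : Ω → α) (g : Ω → β) (a : α) (b : β) :
    law p (fun ω => (f ω, g ω)) (a, b) ≤ law p g b := by
  rw [← sum_law_prod_left p f g b]
  exact Finset.single_le_sum (f := fun a => law p (fun ω => (f ω, g ω)) (a, b))
    (fun a _ => law_nonneg hp _ _) (Finset.mem_univ a)

theorem sum_law [Fintype α] (p : Ω → ℝ) (f : Ω → α) : ∑ a, law p f a = ∑ ω, p ω := by
  simpa using sum_law_mul p f (fun _ => 1)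

variable [Fintype α] [Fintype β] [Fintype γ]

theorem condEntropy_eq_sum (p : Ω → ℝ) (f : Ω → α) (g : Ω → β) :
    condEntropy p f g = - ∑ ω, p ω *
      Real.logb 2 (law p (fun ω => (f ω, g ω)) (f ω, g ω) / law p g (g ω)) := by
  unfold condEntropy
  rw [← Fintype.sum_prod_type' (f := fun a b => law p (fun ω => (f ω, g ω)) (a, b) *
      Real.logb 2 (law p (fun ω => (f ω, g ω)) (a, b) / law p g b)),
    ← sum_law_mul p (fun ω => (f ω, g ω)) (fun q =>
      Real.logb 2 (law p (fun ω => (f ω, g ω)) q / law p g q.2))]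

theorem mutualInfo_eq_sum (p : Ω → ℝ) (f : Ω → α) (g : Ω → β) :
    mutualInfo p f g = ∑ ω, p ω *
      Real.logb 2 (law p (fun ω => (f ω, g ω)) (f ω, g ω) / (law p f (f ω) * law p g (g ω))) := by
  unfold mutualInfo
  rw [← Fintype.sum_prod_type' (f := fun a b => law p (fun ω => (f ω, g ω)) (a, b) *
      Real.logb 2 (law p (fun ω => (f ω, g ω)) (a, b) / (law p f a * law p g b))),
    ← sum_law_mul p (fun ω => (f ω, g ω)) (fun q =>
      Real.logb 2 (law p (fun ω => (f ω, g ω)) q / (law p f q.1 * law p g q.2)))]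

theorem condEntropy_comp_left {e : α → γ} (he : Function.Injective e) (p : Ω → ℝ) (f : Ω → α)
    (g : Ω → β) : condEntropy p (fun ω => e (f ω)) g = condEntropy p f g := by
  simp only [condEntropy_eq_sum]
  congr 1
  refine Finset.sum_congr rfl fun ω _ => ?_
  rw [← law_comp_injective (he.prodMap Function.injective_id) p (fun ω => (f ω, g ω))]
  rfl

theorem condEntropy_comp_right {e : β → γ} (he : Function.Injective e) (p : Ω → ℝ) (f : Ω → α)
    (g : Ω → β) : condEntropy p f (fun ω => e (g ω)) = condEntropy p f g := by
  simp only [condEntropy_eq_sum]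
  congr 1
  refine Finset.sum_congr rfl fun ω _ => ?_
  rw [← law_comp_injective (Function.injective_id.prodMap he) p (fun ω => (f ω, g ω)),
    law_comp_injective he]
  rfl

theorem condEntropy_nonneg (hp : ∀ ω, 0 ≤ p ω) (f : Ω → α) (g : Ω → β) :
    0 ≤ condEntropy p f g := by
  rw [condEntropy_eq_sum, neg_nonneg]
  refine Finset.sum_nonpos fun ω _ => mul_nonpos_of_nonneg_of_nonpos (hp ω) ?_
  exact Real.logb_nonpos (by norm_num) (div_nonneg (law_nonneg hp _ _) (law_nonneg hp _ _))
    (div_le_one_of_le₀ (law_prod_le hp _ _ _ _) (law_nonneg hp _ _))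

theorem condEntropy_const (hp : ∀ ω, 0 ≤ p ω) (c : α) (g : Ω → β) :
    condEntropy p (fun _ => c) g = 0 := by
  rw [condEntropy_eq_sum, neg_eq_zero]
  refine Finset.sum_eq_zero fun ω _ => ?_
  have h : law p (fun ω => (c, g ω)) (c, g ω) = law p g (g ω) :=
    law_comp_injective (e := fun b => (c, b)) (fun _ _ h => (Prod.ext_iff.1 h).2) p g (g ω)
  rcases (hp ω).eq_or_lt with h0 | h0
  · rw [← h0, zero_mul]
  · rw [h, div_self (law_pos hp g h0).ne', Real.logb_one, mul_zero]

/-- Gibbs' inequality. -/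
theorem mutualInfo_nonneg (hp : ∀ ω, 0 ≤ p ω) (hp1 : ∑ ω, p ω = 1) (f : Ω → α) (g : Ω → β) :
    0 ≤ mutualInfo p f g := by
  have hlog : (0 : ℝ) < Real.log 2 := Real.log_pos (by norm_num)
  set P := law p (fun ω => (f ω, g ω)) with hP
  have key : ∀ q : α × β, (P q - law p f q.1 * law p g q.2) / Real.log 2 ≤
      P q * Real.logb 2 (P q / (law p f q.1 * law p g q.2)) := by
    intro q
    have hQ : 0 ≤ law p f q.1 * law p g q.2 := mul_nonneg (law_nonneg hp _ _) (law_nonneg hp _ _)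
    rw [Real.logb, ← mul_div_assoc]
    refine div_le_div_of_nonneg_right ?_ hlog.le
    rcases (law_nonneg hp (fun ω => (f ω, g ω)) q).eq_or_lt with h0 | h0
    · rw [hP, ← h0]; linarith
    rcases hQ.eq_or_lt with hQ0 | hQ0
    · exfalso
      have hg : P q ≤ law p g q.2 := law_prod_le hp f g q.1 q.2
      have hf : P q ≤ law p f q.1 := by
        have h1 := law_prod_le hp g f q.2 q.1
        have h2 := law_comp_injective Prod.swap_injective p (fun ω => (f ω, g ω)) q
        rw [hP, ← h2]; exact h1
      have := mul_pos (h0.trans_le hf) (h0.trans_le hg)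
      linarith
    · have h1 := Real.one_sub_inv_le_log_of_pos (div_pos h0 hQ0)
      rw [inv_div] at h1
      calc P q - law p f q.1 * law p g q.2
          = P q * (1 - law p f q.1 * law p g q.2 / P q) := by
            rw [mul_sub, mul_one, mul_div_cancel₀ _ h0.ne']
        _ ≤ _ := mul_le_mul_of_nonneg_left h1 h0.le
  have hsum : mutualInfo p f g =
      ∑ q : α × β, P q * Real.logb 2 (P q / (law p f q.1 * law p g q.2)) :=
    (Fintype.sum_prod_type' (f := fun a b => P (a, b) *
      Real.logb 2 (P (a, b) / (law p f a * law p g b)))).symm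
  rw [hsum]
  refine le_trans (le_of_eq ?_) (Finset.sum_le_sum fun q _ => key q)
  rw [← Finset.sum_div, Finset.sum_sub_distrib, sum_law, Fintype.sum_prod_type]
  simp [← Finset.mul_sum, sum_law, hp1]

end Law

/-! ### Masked relay outputs -/

section Mask

variable {N : ℕ} {YR : Fin N → Type*}

/-- The outputs of the relays in `S`; those of the other relays are erased. -/
def mask (S : Finset (Fin N)) (ys : ∀ i, YR i) (i : Fin N) : Option (YR i) :=
  if i ∈ S then some (ys i) else none

/-- The probability that the independent events `i : Fin N` of probabilities `q i` that occur are
those in `S`. -/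
def subsetProb (q : Fin N → ℝ) (S : Finset (Fin N)) : ℝ :=
  (∏ i ∈ Sᶜ, (1 - q i)) * ∏ i ∈ S, q i

theorem sum_subsetProb (q : Fin N → ℝ) : ∑ S, subsetProb q S = 1 := by
  have h := Fintype.prod_add q (fun i => 1 - q i)
  simp only [add_sub_cancel, Finset.prod_const_one] at h
  rw [h]
  exact Finset.sum_congr rfl fun S _ => mul_comm _ _

theorem subsetProb_nonneg {q : Fin N → ℝ} (hq : ∀ i, q i ∈ Set.Icc (0 : ℝ) 1)
    (S : Finset (Fin N)) : 0 ≤ subsetProb q S :=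
  mul_nonneg (Finset.prod_nonneg fun i _ => sub_nonneg.2 (hq i).2)
    (Finset.prod_nonneg fun i _ => (hq i).1)

theorem sum_subsetProb_mul_mem (q : Fin N → ℝ) (i : Fin N) (c : ℝ) :
    ∑ S, subsetProb q S * (if i ∈ S then c else 0) = q i * c := by
  -- Replace the factor `1 - q i` by `0` in the expansion of `∏ (q j + (1 - q j))`.
  have h := Fintype.prod_add q (fun j => if j = i then 0 else 1 - q j)
  have hl : ∏ j, (q j + if j = i then 0 else 1 - q j) = q i := by
    rw [Fintype.prod_eq_single i]
    · simp
    · intro j hj; simp [hj]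
  rw [← hl, h, Finset.sum_mul]
  refine Finset.sum_congr rfl fun S _ => ?_
  by_cases hi : i ∈ S
  · rw [if_pos hi]
    have : ∏ j ∈ Sᶜ, (if j = i then 0 else 1 - q j) = ∏ j ∈ Sᶜ, (1 - q j) := by
      refine Finset.prod_congr rfl fun j hj => if_neg ?_
      rintro rfl
      exact Finset.mem_compl.1 hj hi
    rw [this, subsetProb]; ring
  · have : ∏ j ∈ Sᶜ, (if j = i then 0 else 1 - q j) = 0 :=
      Finset.prod_eq_zero (Finset.mem_compl.2 hi) (by simp)
    rw [if_neg hi, this]; ring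

/-- Erasing the outputs outside `S` keeps the same information as restricting to `S`. -/
theorem exists_injective_mask (S : Finset (Fin N)) :
    ∃ e : (∀ i : S, YR i) → ∀ i, Option (YR i), Function.Injective e ∧
      ∀ ys : ∀ i, YR i, mask S ys = e fun i : S => ys i := by
  refine ⟨fun v i => if h : i ∈ S then some (v ⟨i, h⟩) else none, ?_, ?_⟩
  · intro v v' h
    ext i
    have := congrFun h i
    simpa [i.2] using this
  · intro ys
    ext1 i
    by_cases h : i ∈ S <;> simp [mask, h]

end Mask

/-! ### The random code for the relay channel -/

namespace RelayChannel

variable {N : ℕ} {X Y : Type*} {XR YR : Fin N → Type*}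
  [Fintype X] [Fintype Y] [∀ i, Fintype (XR i)] [∀ i, Fintype (YR i)]
  (W : RelayChannel N X Y XR YR) {pX : X → ℝ} {pR : ∀ i, XR i → ℝ}

theorem joint_nonneg (hpX : pX ∈ stdSimplex ℝ X) (hpR : ∀ i, pR i ∈ stdSimplex ℝ (XR i))
    (ω : X × (∀ i, XR i) × Y × (∀ i, YR i)) : 0 ≤ W.joint pX pR ω :=
  mul_nonneg (mul_nonneg (hpX.1 _) (Finset.prod_nonneg fun i _ => (hpR i).1 _))
    ((W.prob_mem _ _).1 _)

theorem sum_joint_mul (F : X → (∀ i, XR i) → ℝ) :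
    ∑ ω, W.joint pX pR ω * F ω.1 ω.2.1 = ∑ x, ∑ xs, pX x * (∏ i, pR i (xs i)) * F x xs := by
  rw [Fintype.sum_prod_type]
  refine Finset.sum_congr rfl fun x _ => ?_
  rw [Fintype.sum_prod_type]
  refine Finset.sum_congr rfl fun xs _ => ?_
  simp only [joint]
  rw [← Finset.sum_mul, ← Finset.mul_sum]
  have : ∑ o : Y × (∀ i, YR i), W.prob x xs (o.1, o.2) = 1 := (W.prob_mem x xs).2
  rw [this, mul_one]

theorem sum_relayLaw (hpR : ∀ i, pR i ∈ stdSimplex ℝ (XR i)) :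
    ∑ xs : ∀ i, XR i, ∏ i, pR i (xs i) = 1 := by
  rw [sum_pi_prod pR]
  exact Finset.prod_eq_one fun i _ => (hpR i).2

theorem sum_joint (hpX : pX ∈ stdSimplex ℝ X) (hpR : ∀ i, pR i ∈ stdSimplex ℝ (XR i)) :
    ∑ ω, W.joint pX pR ω = 1 := by
  have := W.sum_joint_mul (pX := pX) (pR := pR) fun _ _ => 1
  simp only [mul_one, ← Finset.mul_sum, sum_relayLaw hpR, hpX.2] at this
  exact this

theorem law_source (hpR : ∀ i, pR i ∈ stdSimplex ℝ (XR i)) (x : X) :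
    law (W.joint pX pR) (fun ω => ω.1) x = pX x := by
  rw [law_eq_sum_iverson, W.sum_joint_mul fun x' _ => iverson (x' = x), Finset.sum_eq_single x]
  · simp only [iverson_true, mul_one, ← Finset.mul_sum, sum_relayLaw hpR]
  · intro x' _ hx'
    simp [iverson_false hx']
  · intro h; exact absurd (Finset.mem_univ _) h

theorem law_relays (hpX : pX ∈ stdSimplex ℝ X) (xs : ∀ i, XR i) :
    law (W.joint pX pR) (fun ω => ω.2.1) xs = ∏ i, pR i (xs i) := by
  rw [law_eq_sum_iverson, W.sum_joint_mul fun _ xs' => iverson (xs' = xs), Finset.sum_comm,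
    Finset.sum_eq_single xs]
  · simp only [iverson_true, mul_one, ← Finset.sum_mul, hpX.2, one_mul]
  · intro xs' _ hx'
    simp [iverson_false hx']
  · intro h; exact absurd (Finset.mem_univ _) h

theorem law_source_relays (x : X) (xs : ∀ i, XR i) :
    law (W.joint pX pR) (fun ω => (ω.1, ω.2.1)) (x, xs) = pX x * ∏ i, pR i (xs i) := by
  rw [law_eq_sum_iverson, W.sum_joint_mul fun x' xs' => iverson ((x', xs') = (x, xs)),
    ← Fintype.sum_prod_type' (f := fun x' xs' => pX x' * (∏ i, pR i (xs' i)) *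
      iverson ((x', xs') = (x, xs))), Finset.sum_eq_single (x, xs)]
  · simp [iverson_true]
  · intro q _ hq
    rw [iverson_false hq, mul_zero]
  · intro h; exact absurd (Finset.mem_univ _) h

theorem law_relay (hpX : pX ∈ stdSimplex ℝ X) (hpR : ∀ i, pR i ∈ stdSimplex ℝ (XR i))
    (i : Fin N) (a : XR i) : law (W.joint pX pR) (fun ω => ω.2.1 i) a = pR i a := by
  rw [law_eq_sum_iverson, W.sum_joint_mul fun _ xs => iverson (xs i = a)]
  have h : ∑ xs : ∀ i, XR i, (∏ i, pR i (xs i)) * iverson (xs i = a) = pR i a := by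
    rw [sum_exchange (v := pR i) (fun xs : ∀ i, XR i => xs i) (fun xs b => Function.update xs i b)
      (hpR i).2 (by simp) (by simp) (fun c b => prod_update_exchange pR c i b)]
    simp only [Function.update_self]
    rw [← Finset.sum_mul, sum_relayLaw hpR, one_mul, Finset.sum_eq_single a]
    · rw [iverson_true rfl, mul_one]
    · intro b _ hb
      rw [iverson_false hb, mul_zero]
    · intro h; exact absurd (Finset.mem_univ _) h
  simp only [mul_assoc, ← Finset.mul_sum, h]
  rw [← Finset.sum_mul, hpX.2, one_mul]

/-- The experiment behind one channel use: relay `i` reports its output with probability `q i`,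
independently of everything else, and the scores are the likelihood ratios
`p(xᵢ, y) / (p(xᵢ) p(y))` and `p(x | yₛ, 𝐱, y) / p(x)`, and the conditional probability
`p(yᵢ | 𝐱, y)` of a report. -/
def experiment (hpX : pX ∈ stdSimplex ℝ X) (hpR : ∀ i, pR i ∈ stdSimplex ℝ (XR i))
    {q : Fin N → ℝ} (hq : ∀ i, q i ∈ Set.Icc (0 : ℝ) 1) :
    Experiment (Fin N) (Finset (Fin N)) X Y (Y × (∀ i, YR i)) XR (fun i => Option (YR i)) where
  V := W.prob
  V_nonneg x xs := (W.prob_mem x xs).1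
  V_sum x xs := (W.prob_mem x xs).2
  yOf o := o.1
  zOf S o := mask S o.2
  pT := subsetProb q
  pT_nonneg := subsetProb_nonneg hq
  pT_sum := sum_subsetProb q
  pX := pX
  pX_nonneg := hpX.1
  pX_sum := hpX.2
  pR := pR
  pR_nonneg i := (hpR i).1
  pR_sum i := (hpR i).2
  f i a y := law (W.joint pX pR) (fun ω => (ω.2.1 i, ω.2.2.1)) (a, y) /
    (law (W.joint pX pR) (fun ω => ω.2.1 i) a * law (W.joint pX pR) (fun ω => ω.2.2.1) y)
  f_nonneg i a y := div_nonneg (law_nonneg (W.joint_nonneg hpX hpR) _ _)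
    (mul_nonneg (law_nonneg (W.joint_nonneg hpX hpR) _ _)
      (law_nonneg (W.joint_nonneg hpX hpR) _ _))
  f_sum i y := by
    simpa only [W.law_relay hpX hpR] using sum_law_mul_div_le_one (W.joint_nonneg hpX hpR)
      (fun ω => ω.2.1 i) (fun ω => ω.2.2.1) y
  g i S xs y z := law (W.joint pX pR) (fun ω => (mask S ω.2.2.2 i, (ω.2.1, ω.2.2.1)))
      (z, (xs, y)) / law (W.joint pX pR) (fun ω => (ω.2.1, ω.2.2.1)) (xs, y)
  g_nonneg i S xs y z := div_nonneg (law_nonneg (W.joint_nonneg hpX hpR) _ _)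
    (law_nonneg (W.joint_nonneg hpX hpR) _ _)
  g_sum i S xs y := sum_law_div_law_le_one _ _ _ _
  φ S xs y z x := law (W.joint pX pR)
      (fun ω => (ω.1, (mask S ω.2.2.2, (ω.2.1, ω.2.2.1)))) (x, (z, (xs, y))) /
    (law (W.joint pX pR) (fun ω => ω.1) x *
      law (W.joint pX pR) (fun ω => (mask S ω.2.2.2, (ω.2.1, ω.2.2.1))) (z, (xs, y)))
  φ_nonneg S xs y z x := div_nonneg (law_nonneg (W.joint_nonneg hpX hpR) _ _)
    (mul_nonneg (law_nonneg (W.joint_nonneg hpX hpR) _ _)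
      (law_nonneg (W.joint_nonneg hpX hpR) _ _))
  φ_sum S xs y z := by
    simpa only [W.law_source hpR] using sum_law_mul_div_le_one (W.joint_nonneg hpX hpR)
      (fun ω => ω.1) (fun ω => (mask S ω.2.2.2, (ω.2.1, ω.2.2.1))) (z, (xs, y))

variable (hpX : pX ∈ stdSimplex ℝ X) (hpR : ∀ i, pR i ∈ stdSimplex ℝ (XR i))
    {q : Fin N → ℝ} (hq : ∀ i, q i ∈ Set.Icc (0 : ℝ) 1)

theorem letterLaw_experiment (ω : Finset (Fin N) × X × (∀ i, XR i) × Y × (∀ i, YR i)) :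
    (W.experiment hpX hpR hq).letterLaw ω = subsetProb q ω.1 * W.joint pX pR ω.2 := by
  simp only [Experiment.letterLaw, experiment, joint]
  ring

theorem sum_letterLaw_experiment_mul
    (F : Finset (Fin N) → X × (∀ i, XR i) × Y × (∀ i, YR i) → ℝ) :
    ∑ ω, (W.experiment hpX hpR hq).letterLaw ω * F ω.1 ω.2 =
      ∑ S, subsetProb q S * ∑ ω, W.joint pX pR ω * F S ω := by
  rw [Fintype.sum_prod_type]
  refine Finset.sum_congr rfl fun S _ => ?_
  rw [Finset.mul_sum]
  refine Finset.sum_congr rfl fun ω _ => ?_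
  rw [letterLaw_experiment, mul_assoc]

theorem joint_pos_of_letterLaw_pos {ω : Finset (Fin N) × X × (∀ i, XR i) × Y × (∀ i, YR i)}
    (h : 0 < (W.experiment hpX hpR hq).letterLaw ω) : 0 < W.joint pX pR ω.2 := by
  rw [letterLaw_experiment] at h
  exact pos_of_mul_pos_right h (subsetProb_nonneg hq _)

theorem experiment_f_pos (i : Fin N) (ω : Finset (Fin N) × X × (∀ i, XR i) × Y × (∀ i, YR i))
    (h : 0 < (W.experiment hpX hpR hq).letterLaw ω) :
    0 < (W.experiment hpX hpR hq).f i (ω.2.2.1 i) ((W.experiment hpX hpR hq).yOf ω.2.2.2) := by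
  have h0 := W.joint_pos_of_letterLaw_pos hpX hpR hq h
  have hp := W.joint_nonneg hpX hpR
  exact div_pos (law_pos hp (fun ω => (ω.2.1 i, ω.2.2.1)) h0)
    (mul_pos (law_pos hp (fun ω => ω.2.1 i) h0) (law_pos hp (fun ω => ω.2.2.1) h0))

theorem experiment_g_pos (i : Fin N) (ω : Finset (Fin N) × X × (∀ i, XR i) × Y × (∀ i, YR i))
    (h : 0 < (W.experiment hpX hpR hq).letterLaw ω) :
    0 < (W.experiment hpX hpR hq).g i ω.1 ω.2.2.1 ((W.experiment hpX hpR hq).yOf ω.2.2.2)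
      ((W.experiment hpX hpR hq).zOf ω.1 ω.2.2.2 i) := by
  have h0 := W.joint_pos_of_letterLaw_pos hpX hpR hq h
  have hp := W.joint_nonneg hpX hpR
  exact div_pos (law_pos hp (fun ω' => (mask ω.1 ω'.2.2.2 i, (ω'.2.1, ω'.2.2.1))) h0)
    (law_pos hp (fun ω => (ω.2.1, ω.2.2.1)) h0)

theorem experiment_φ_pos (ω : Finset (Fin N) × X × (∀ i, XR i) × Y × (∀ i, YR i))
    (h : 0 < (W.experiment hpX hpR hq).letterLaw ω) :
    0 < (W.experiment hpX hpR hq).φ ω.1 ω.2.2.1 ((W.experiment hpX hpR hq).yOf ω.2.2.2)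
      ((W.experiment hpX hpR hq).zOf ω.1 ω.2.2.2) ω.2.1 := by
  have h0 := W.joint_pos_of_letterLaw_pos hpX hpR hq h
  have hp := W.joint_nonneg hpX hpR
  exact div_pos (law_pos hp (fun ω' => (ω'.1, (mask ω.1 ω'.2.2.2, (ω'.2.1, ω'.2.2.1)))) h0)
    (mul_pos (law_pos hp (fun ω => ω.1) h0)
      (law_pos hp (fun ω' => (mask ω.1 ω'.2.2.2, (ω'.2.1, ω'.2.2.1))) h0))

/-- `H(Yᵢ | 𝐗, Y)`. -/
def reportEntropy (pX : X → ℝ) (pR : ∀ i, XR i → ℝ) (i : Fin N) : ℝ :=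
  condEntropy (W.joint pX pR) (fun ω => ω.2.2.2 i) (fun ω => (ω.2.1, ω.2.2.1))

/-- `I(Xᵢ; Y)`. -/
def linkInfo (pX : X → ℝ) (pR : ∀ i, XR i → ℝ) (i : Fin N) : ℝ :=
  mutualInfo (W.joint pX pR) (fun ω => ω.2.1 i) (fun ω => ω.2.2.1)

/-- The rate obtained when relay `i` reports a fraction `q i` of its outputs. -/
def reportRate (pX : X → ℝ) (pR : ∀ i, XR i → ℝ) (q : Fin N → ℝ) : ℝ :=
  condMutualInfo (W.joint pX pR) (fun ω => ω.1) (fun ω => ω.2.2.1) (fun ω => ω.2.1) +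
    ∑ S : Finset (Fin N) with S.Nonempty, subsetProb q S *
      condMutualInfo (W.joint pX pR) (fun ω => ω.1) (fun ω => fun i : S => ω.2.2.2 i)
        (fun ω => (ω.2.1, ω.2.2.1))

theorem sum_letterLaw_logb_f (i : Fin N) :
    ∑ ω, (W.experiment hpX hpR hq).letterLaw ω * Real.logb 2 ((W.experiment hpX hpR hq).f i
      (ω.2.2.1 i) ((W.experiment hpX hpR hq).yOf ω.2.2.2)) = W.linkInfo pX pR i := by
  refine (W.sum_letterLaw_experiment_mul hpX hpR hq fun _ ω => Real.logb 2
    ((W.experiment hpX hpR hq).f i (ω.2.1 i) ω.2.2.1)).trans ?_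
  rw [← Finset.sum_mul, sum_subsetProb, one_mul, linkInfo, mutualInfo_eq_sum]
  rfl

theorem condEntropy_mask (hpX : pX ∈ stdSimplex ℝ X)
    (hpR : ∀ i, pR i ∈ stdSimplex ℝ (XR i)) (S : Finset (Fin N)) (i : Fin N) :
    condEntropy (W.joint pX pR) (fun ω => mask S ω.2.2.2 i) (fun ω => (ω.2.1, ω.2.2.1)) =
      if i ∈ S then W.reportEntropy pX pR i else 0 := by
  by_cases hi : i ∈ S
  · simp only [mask, if_pos hi]
    exact condEntropy_comp_left (Option.some_injective _) _ _ _
  · simp only [mask, if_neg hi]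
    exact condEntropy_const (W.joint_nonneg hpX hpR) _ _

theorem sum_letterLaw_logb_g (i : Fin N) :
    ∑ ω, (W.experiment hpX hpR hq).letterLaw ω * Real.logb 2 ((W.experiment hpX hpR hq).g i
      ω.1 ω.2.2.1 ((W.experiment hpX hpR hq).yOf ω.2.2.2)
        ((W.experiment hpX hpR hq).zOf ω.1 ω.2.2.2 i)) = - (q i * W.reportEntropy pX pR i) := by
  refine (W.sum_letterLaw_experiment_mul hpX hpR hq fun S ω => Real.logb 2
    ((W.experiment hpX hpR hq).g i S ω.2.1 ω.2.2.1 (mask S ω.2.2.2 i))).trans ?_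
  rw [← sum_subsetProb_mul_mem, ← Finset.sum_neg_distrib]
  refine Finset.sum_congr rfl fun S _ => ?_
  rw [← W.condEntropy_mask hpX hpR, condEntropy_eq_sum, mul_neg, neg_neg]
  rfl

/-- The source and the relays are independent, so that `H(X | 𝐗) = - ∑ p(x) log₂ p(x)`. -/
theorem condEntropy_source_relays (hpX : pX ∈ stdSimplex ℝ X)
    (hpR : ∀ i, pR i ∈ stdSimplex ℝ (XR i)) :
    condEntropy (W.joint pX pR) (fun ω => ω.1) (fun ω => ω.2.1) =
      - ∑ ω, W.joint pX pR ω * Real.logb 2 (law (W.joint pX pR) (fun ω => ω.1) ω.1) := by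
  rw [condEntropy_eq_sum]
  congr 1
  refine Finset.sum_congr rfl fun ω _ => ?_
  rcases (W.joint_nonneg hpX hpR ω).eq_or_lt with h0 | h0
  · rw [← h0, zero_mul, zero_mul]
  · have h1 := law_pos (W.joint_nonneg hpX hpR) (fun ω => ω.2.1) h0
    simp only [W.law_source_relays, W.law_relays hpX, W.law_source hpR] at h1 ⊢
    rw [mul_div_cancel_right₀ _ h1.ne']

theorem condMutualInfo_restrict (S : Finset (Fin N)) :
    condMutualInfo (W.joint pX pR) (fun ω => ω.1) (fun ω => fun i : S => ω.2.2.2 i)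
        (fun ω => (ω.2.1, ω.2.2.1)) =
      condMutualInfo (W.joint pX pR) (fun ω => ω.1) (fun ω => mask S ω.2.2.2)
        (fun ω => (ω.2.1, ω.2.2.1)) := by
  obtain ⟨e, he, hm⟩ := exists_injective_mask (YR := YR) S
  unfold condMutualInfo
  congr 1
  simp only [hm]
  exact (condEntropy_comp_right (he.prodMap Function.injective_id) (W.joint pX pR) (fun ω => ω.1)
    (fun ω => ((fun i : S => ω.2.2.2 i), (ω.2.1, ω.2.2.1)))).symm

theorem condMutualInfo_mask_empty :
    condMutualInfo (W.joint pX pR) (fun ω => ω.1) (fun ω => mask (∅ : Finset (Fin N)) ω.2.2.2)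
      (fun ω => (ω.2.1, ω.2.2.1)) = 0 := by
  unfold condMutualInfo
  rw [sub_eq_zero]
  exact (condEntropy_comp_right
    (e := fun b : (∀ i, XR i) × Y => ((fun _ => none : ∀ i, Option (YR i)), b))
    (fun _ _ h => (Prod.ext_iff.1 h).2) (W.joint pX pR) (fun ω => ω.1)
    (fun ω => (ω.2.1, ω.2.2.1))).symm

theorem reportRate_eq_sum :
    W.reportRate pX pR q = ∑ S, subsetProb q S *
      (condMutualInfo (W.joint pX pR) (fun ω => ω.1) (fun ω => ω.2.2.1) (fun ω => ω.2.1) +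
        condMutualInfo (W.joint pX pR) (fun ω => ω.1) (fun ω => mask S ω.2.2.2)
          (fun ω => (ω.2.1, ω.2.2.1))) := by
  simp only [mul_add, Finset.sum_add_distrib]
  rw [← Finset.sum_mul, sum_subsetProb, one_mul, reportRate]
  congr 1
  simp only [condMutualInfo_restrict]
  refine Finset.sum_subset (Finset.filter_subset _ _) fun S _ hS => ?_
  have : S = ∅ := by simpa using hS
  rw [this, condMutualInfo_mask_empty, mul_zero]

theorem sum_letterLaw_logb_φ :
    ∑ ω, (W.experiment hpX hpR hq).letterLaw ω * Real.logb 2 ((W.experiment hpX hpR hq).φ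
      ω.1 ω.2.2.1 ((W.experiment hpX hpR hq).yOf ω.2.2.2)
        ((W.experiment hpX hpR hq).zOf ω.1 ω.2.2.2) ω.2.1) = W.reportRate pX pR q := by
  refine (W.sum_letterLaw_experiment_mul hpX hpR hq fun S ω => Real.logb 2
    ((W.experiment hpX hpR hq).φ S ω.2.1 ω.2.2.1 (mask S ω.2.2.2) ω.1)).trans ?_
  rw [reportRate_eq_sum]
  refine Finset.sum_congr rfl fun S _ => ?_
  congr 1
  have hswap : condEntropy (W.joint pX pR) (fun ω => ω.1) (fun ω => (ω.2.2.1, ω.2.1)) =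
      condEntropy (W.joint pX pR) (fun ω => ω.1) (fun ω => (ω.2.1, ω.2.2.1)) :=
    condEntropy_comp_right Prod.swap_injective (W.joint pX pR) (fun ω => ω.1)
      (fun ω => (ω.2.1, ω.2.2.1))
  unfold condMutualInfo
  rw [hswap, sub_add_sub_cancel, W.condEntropy_source_relays hpX hpR, condEntropy_eq_sum,
    sub_neg_eq_add, neg_add_eq_sub, ← Finset.sum_sub_distrib]
  refine Finset.sum_congr rfl fun ω _ => ?_
  rcases (W.joint_nonneg hpX hpR ω).eq_or_lt with h0 | h0
  · rw [← h0]; ring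
  · have hp := W.joint_nonneg hpX hpR
    have h1 := law_pos hp (fun ω => ω.1) h0
    have h2 := law_pos hp (fun ω => (mask S ω.2.2.2, (ω.2.1, ω.2.2.1))) h0
    have h3 := law_pos hp (fun ω => (ω.1, (mask S ω.2.2.2, (ω.2.1, ω.2.2.1)))) h0
    rw [← mul_sub, ← Real.logb_div (div_pos h3 h2).ne' h1.ne', div_div, mul_comm (law _ _ _)
      (law _ _ ω.1)]
    rfl

end RelayChannel

/-! ### Choice of the parameters -/

theorem tendsto_two_rpow_mul {r : ℝ} (hr : r < 0) :
    Tendsto (fun m : ℕ => (2 : ℝ) ^ ((m : ℝ) * r)) atTop (𝓝 0) := by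
  have h : (2 : ℝ) ^ r < 1 := Real.rpow_lt_one_of_one_lt_of_neg (by norm_num) hr
  refine (tendsto_pow_atTop_nhds_zero_of_lt_one (by positivity) h).congr fun m => ?_
  rw [mul_comm, Real.rpow_mul_natCast (by norm_num)]

theorem two_rpow_mul_div (m : ℕ) (b c : ℝ) :
    (2 : ℝ) ^ ((m : ℝ) * b) / 2 ^ ((m : ℝ) * c) = 2 ^ ((m : ℝ) * (b - c)) := by
  rw [← Real.rpow_sub two_pos, mul_sub]

theorem tendsto_ceil_sub_one_div {b c : ℝ} (h : b < c) :
    Tendsto (fun m : ℕ => ((⌈(2 : ℝ) ^ ((m : ℝ) * b)⌉₊ : ℝ) - 1) / 2 ^ ((m : ℝ) * c))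
      atTop (𝓝 0) := by
  refine squeeze_zero (fun m => ?_) (fun m => ?_) (tendsto_two_rpow_mul (sub_neg.2 h))
  · have : (1 : ℝ) ≤ ⌈(2 : ℝ) ^ ((m : ℝ) * b)⌉₊ := by
      exact_mod_cast Nat.one_le_iff_ne_zero.2 (Nat.ceil_pos.2 (by positivity)).ne'
    exact div_nonneg (by linarith) (by positivity)
  · rw [← two_rpow_mul_div]
    have := Nat.ceil_lt_add_one (a := (2 : ℝ) ^ ((m : ℝ) * b)) (by positivity)
    gcongr
    linarith

theorem tendsto_sub_one_div_ceil {a b : ℝ} (ha : 0 ≤ a) (h : a < b) :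
    Tendsto (fun m : ℕ => ((2 : ℝ) ^ ((m : ℝ) * a) - 1) / ⌈(2 : ℝ) ^ ((m : ℝ) * b)⌉₊)
      atTop (𝓝 0) := by
  refine squeeze_zero (fun m => ?_) (fun m => ?_) (tendsto_two_rpow_mul (sub_neg.2 h))
  · have : (1 : ℝ) ≤ (2 : ℝ) ^ ((m : ℝ) * a) := Real.one_le_rpow (by norm_num) (by positivity)
    exact div_nonneg (by linarith) (by positivity)
  · rw [← two_rpow_mul_div]
    have := Nat.le_ceil ((2 : ℝ) ^ ((m : ℝ) * b))
    gcongr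
    linarith

/-- A conditional probability whose expected logarithm vanishes is almost surely `1`. -/
theorem Experiment.mean_pow_iverson_lt_one_eq_zero {ι 𝒯 𝒳 𝒴 𝒪 : Type*} {𝒳r 𝒵 : ι → Type*}
    [Fintype ι] [DecidableEq ι] [Fintype 𝒯] [Fintype 𝒳] [Fintype 𝒪] [∀ i, Fintype (𝒳r i)]
    [∀ i, Fintype (𝒵 i)] (E : Experiment ι 𝒯 𝒳 𝒴 𝒪 𝒳r 𝒵) (i : ι)
    (hpos : ∀ ω, 0 < E.letterLaw ω →
      0 < E.g i ω.1 ω.2.2.1 (E.yOf ω.2.2.2) (E.zOf ω.1 ω.2.2.2 i))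
    (h0 : ∑ ω, E.letterLaw ω *
      Real.logb 2 (E.g i ω.1 ω.2.2.1 (E.yOf ω.2.2.2) (E.zOf ω.1 ω.2.2.2 i)) = 0) (m : ℕ) :
    (E.pow m).mean (fun T _ xs o => iverson
      ((E.pow m).g i T xs ((E.pow m).yOf o) ((E.pow m).zOf T o i) < 1)) = 0 := by
  have hle : ∀ T xs y z, E.g i T xs y z ≤ 1 := fun T xs y z =>
    (Finset.single_le_sum (f := fun z => E.g i T xs y z) (fun z _ => E.g_nonneg _ _ _ _ _)
      (Finset.mem_univ z)).trans (E.g_sum _ _ _ _)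
  have hone : ∀ ω, 0 < E.letterLaw ω →
      E.g i ω.1 ω.2.2.1 (E.yOf ω.2.2.2) (E.zOf ω.1 ω.2.2.2 i) = 1 := by
    intro ω hω
    have hterm := (Finset.sum_eq_zero_iff_of_nonpos fun ω _ =>
      mul_nonpos_of_nonneg_of_nonpos (E.letterLaw_nonneg ω)
        (Real.logb_nonpos (by norm_num) (E.g_nonneg _ _ _ _ _) (hle _ _ _ _))).1 h0 ω
          (Finset.mem_univ ω)
    rcases Real.logb_eq_zero.1 ((mul_eq_zero.1 hterm).resolve_left hω.ne') with
      h | h | h | h | h | h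
    · norm_num at h
    · norm_num at h
    · norm_num at h
    · exact absurd h (hpos ω hω).ne'
    · exact h
    · linarith [hpos ω hω]
  rw [mean_pow]
  refine Finset.sum_eq_zero fun ω _ => ?_
  by_cases h : ∀ t, 0 < E.letterLaw (ω t)
  · rw [iverson_false, mul_zero]
    rw [not_lt]
    have h1 : ∏ t, E.g i (ω t).1 (ω t).2.2.1 (E.yOf (ω t).2.2.2)
        (E.zOf (ω t).1 (ω t).2.2.2 i) = 1 := Finset.prod_eq_one fun t _ => hone (ω t) (h t)
    exact h1.ge
  · push Not at h
    obtain ⟨t, ht⟩ := h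
    rw [Finset.prod_eq_zero (Finset.mem_univ t) (le_antisymm ht (E.letterLaw_nonneg _)), zero_mul]

theorem nonempty_of_mem_stdSimplex {α : Type*} [Fintype α] {p : α → ℝ}
    (hp : p ∈ stdSimplex ℝ α) : Nonempty α := by
  by_contra h
  rw [not_nonempty_iff] at h
  simpa using hp.2

namespace RelayChannel

variable {N : ℕ} {X Y : Type*} {XR YR : Fin N → Type*}
  [Fintype X] [Fintype Y] [∀ i, Fintype (XR i)] [∀ i, Fintype (YR i)]
  (W : RelayChannel N X Y XR YR) {pX : X → ℝ} {pR : ∀ i, XR i → ℝ} {q : Fin N → ℝ}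

/-- If the reports of relay `i` need less than `I(Xᵢ; Y)` bits, or no bits at all, then suitable
numbers `K m` of codewords and hashes exist. -/
theorem exists_thresholds (hpX : pX ∈ stdSimplex ℝ X)
    (hpR : ∀ i, pR i ∈ stdSimplex ℝ (XR i)) (hq : ∀ i, q i ∈ Set.Icc (0 : ℝ) 1)
    (i : Fin N)
    (hi : q i * W.reportEntropy pX pR i < W.linkInfo pX pR i ∨
      (W.linkInfo pX pR i = 0 ∧ q i * W.reportEntropy pX pR i = 0)) :
    ∃ (A G : ℕ → ℝ) (K : ℕ → ℕ), (∀ m, 0 < A m) ∧ (∀ m, 1 ≤ G m) ∧ (∀ m, 0 < K m) ∧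
      Tendsto (fun m => ((W.experiment hpX hpR hq).pow m).mean (fun _ _ xs o =>
        iverson (((W.experiment hpX hpR hq).pow m).f i (xs i)
          (((W.experiment hpX hpR hq).pow m).yOf o) < A m)) + (K m - 1) / A m) atTop (𝓝 0) ∧
      Tendsto (fun m => ((W.experiment hpX hpR hq).pow m).mean (fun T _ xs o =>
        iverson (((W.experiment hpX hpR hq).pow m).g i T xs
          (((W.experiment hpX hpR hq).pow m).yOf o)
          (((W.experiment hpX hpR hq).pow m).zOf T o i) < (G m)⁻¹)) + (G m - 1) / K m)
        atTop (𝓝 0) := by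
  set E := W.experiment hpX hpR hq with hE
  have hf : ∀ c < W.linkInfo pX pR i, Tendsto (fun m => (E.pow m).mean (fun _ _ xs o =>
      iverson ((E.pow m).f i (xs i) ((E.pow m).yOf o) < (2 : ℝ) ^ ((m : ℝ) * c)))) atTop (𝓝 0) := by
    intro c hc
    exact E.tendsto_mean_pow_iverson_lt (fun _ _ xs o => E.f i (xs i) (E.yOf o))
      (W.experiment_f_pos hpX hpR hq i) (hc.trans_eq (W.sum_letterLaw_logb_f hpX hpR hq i).symm)
  have hg : ∀ a, q i * W.reportEntropy pX pR i < a →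
      Tendsto (fun m => (E.pow m).mean (fun T _ xs o =>
        iverson ((E.pow m).g i T xs ((E.pow m).yOf o) ((E.pow m).zOf T o i) <
          (2 : ℝ) ^ ((m : ℝ) * (-a)))) ) atTop (𝓝 0) := by
    intro a ha
    exact E.tendsto_mean_pow_iverson_lt (fun T _ xs o => E.g i T xs (E.yOf o) (E.zOf T o i))
      (W.experiment_g_pos hpX hpR hq i)
      ((neg_lt_neg ha).trans_eq (W.sum_letterLaw_logb_g hpX hpR hq i).symm)
  rcases hi with hi | ⟨hI, hH⟩
  · obtain ⟨b, hb1, hb2⟩ := exists_between hi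
    obtain ⟨a, ha1, ha2⟩ := exists_between hb1
    obtain ⟨c, hc1, hc2⟩ := exists_between hb2
    have ha0 : 0 ≤ a := (mul_nonneg (hq i).1
      (condEntropy_nonneg (W.joint_nonneg hpX hpR) _ _)).trans ha1.le
    refine ⟨fun m => 2 ^ ((m : ℝ) * c), fun m => 2 ^ ((m : ℝ) * a),
      fun m => ⌈(2 : ℝ) ^ ((m : ℝ) * b)⌉₊, fun m => by positivity,
      fun m => Real.one_le_rpow (by norm_num) (by positivity),
      fun m => Nat.ceil_pos.2 (by positivity), ?_, ?_⟩
    · simpa using (hf c hc2).add (tendsto_ceil_sub_one_div hc1)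
    · have := (hg a ha1).add (tendsto_sub_one_div_ceil ha0 ha2)
      simpa [Real.rpow_neg] using this
  -- Nothing has to be sent: there is one codeword, and every report is determined by `(𝐗, Y)`.
  -- With one candidate the threshold `A` only has to be exceeded by the true score, for which any
  -- negative exponent will do.
  · refine ⟨fun m => 2 ^ ((m : ℝ) * (-1)), fun _ => 1, fun _ => 1, fun m => by positivity,
      fun _ => le_rfl, fun _ => one_pos, ?_, ?_⟩
    · simpa using hf (-1) (by rw [hI]; norm_num)
    · have h0 : ∀ m, (E.pow m).mean (fun T _ xs o => iverson
          ((E.pow m).g i T xs ((E.pow m).yOf o) ((E.pow m).zOf T o i) < 1)) = 0 :=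
        E.mean_pow_iverson_lt_one_eq_zero i (W.experiment_g_pos hpX hpR hq i)
          ((W.sum_letterLaw_logb_g hpX hpR hq i).trans (by rw [hH, neg_zero]))
      simp [h0]

/-- Codes of `B + 1` blocks of `m` channel uses, followed by `r` idle ones, whose error probability
tends to zero with `m`, for `⌈2 ^ (m R)⌉ ^ B` or fewer messages. -/
theorem exists_blockCodes (hpX : pX ∈ stdSimplex ℝ X)
    (hpR : ∀ i, pR i ∈ stdSimplex ℝ (XR i)) (hq : ∀ i, q i ∈ Set.Icc (0 : ℝ) 1)
    (hi : ∀ i, q i * W.reportEntropy pX pR i < W.linkInfo pX pR i ∨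
      (W.linkInfo pX pR i = 0 ∧ q i * W.reportEntropy pX pR i = 0))
    {R : ℝ} (hR : R < W.reportRate pX pR q) (B : ℕ) :
    ∃ ε : ℕ → ℝ, Tendsto ε atTop (𝓝 0) ∧ ∀ m r M : ℕ, 0 < M →
      M ≤ ⌈(2 : ℝ) ^ ((m : ℝ) * R)⌉₊ ^ B →
        ∃ c : RelayCode X Y XR YR ((B + 1) * m + r) M, c.errorProb W ≤ ε m := by
  choose A G K hA hG hK h1 h2 using fun i => W.exists_thresholds hpX hpR hq i (hi i)
  set E := W.experiment hpX hpR hq with hE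
  obtain ⟨c, hc1, hc2⟩ := exists_between hR
  set L : ℕ → ℕ := fun m => ⌈(2 : ℝ) ^ ((m : ℝ) * R)⌉₊ with hL
  set eb : ℕ → ℝ := fun m => (E.pow m).errorBound (fun i => A i m) (fun i => G i m)
    ((2 : ℝ) ^ ((m : ℝ) * c)) (fun i => K i m) (fun i => K i m) (L m) with heb
  have heb0 : Tendsto eb atTop (𝓝 0) := by
    have hφ : Tendsto (fun m : ℕ => (E.pow m).mean (fun T x xs o =>
        iverson ((E.pow m).φ T xs ((E.pow m).yOf o) ((E.pow m).zOf T o) x <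
          (2 : ℝ) ^ ((m : ℝ) * c)))) atTop (𝓝 0) :=
      E.tendsto_mean_pow_iverson_lt (fun T x xs o => E.φ T xs (E.yOf o) (E.zOf T o) x)
        (W.experiment_φ_pos hpX hpR hq)
        (hc2.trans_eq (W.sum_letterLaw_logb_φ hpX hpR hq).symm)
    have h3 := hφ.add (tendsto_ceil_sub_one_div hc1)
    have := ((tendsto_finsetSum Finset.univ fun i _ => h1 i).add
      (tendsto_finsetSum Finset.univ fun i _ => h2 i)).add h3
    simpa [heb, Experiment.errorBound] using this
  refine ⟨fun m => (B + 1 : ℕ) * eb m, by simpa using heb0.const_mul ((B + 1 : ℕ) : ℝ),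
    fun m r M hM hMB => ?_⟩
  have hL0 : 0 < L m := Nat.ceil_pos.2 (by positivity)
  obtain ⟨e⟩ : Nonempty (Fin M ↪ (Fin B → Fin (L m))) :=
    Function.Embedding.nonempty_of_card_le (by simpa using hMB)
  let u : Fin M → ℕ → Fin (L m) := fun w j => if h : j < B then e w ⟨j, h⟩ else ⟨0, hL0⟩
  have : ∀ i, Nonempty (Fin (K i m)) := fun i => ⟨⟨0, hK i m⟩⟩
  have haided : ∀ b : ℕ, W.AidedCode (fun i => Fin (K i m)) u (b * m) b (b * eb m) := by
    intro b
    induction b with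
    | zero =>
      simpa using W.aidedCode_zero (fun i => Fin (K i m)) u hM hL0
    | succ b ih =>
      have := ih.step hL0 E rfl (fun _ => rfl)
        (fun i T y => if i ∈ T then some y else none) (fun _ _ _ => rfl) m
        (fun i => hA i m) (fun i => hG i m) (F := (2 : ℝ) ^ ((m : ℝ) * c)) (by positivity)
      simp only [Fintype.card_fin] at this
      rw [Nat.succ_mul]
      push_cast
      rw [add_mul, one_mul]
      exact this
  have : Nonempty X := nonempty_of_mem_stdSimplex hpX
  have : ∀ i, Nonempty (XR i) := fun i => nonempty_of_mem_stdSimplex (hpR i)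
  refine (haided (B + 1)).exists_relayCode hM (fun w w' h => e.injective (funext fun j => ?_)) r
  simpa [u] using h j j.isLt

/-- Rates below `reportRate` are achievable: a message of `n R` bits fits into the `B` message
blocks when `B / (B + 1)` is close enough to `1`. -/
theorem achievable_of_lt_reportRate (hpX : pX ∈ stdSimplex ℝ X)
    (hpR : ∀ i, pR i ∈ stdSimplex ℝ (XR i)) (hq : ∀ i, q i ∈ Set.Icc (0 : ℝ) 1)
    (hi : ∀ i, q i * W.reportEntropy pX pR i < W.linkInfo pX pR i ∨
      (W.linkInfo pX pR i = 0 ∧ q i * W.reportEntropy pX pR i = 0))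
    {R : ℝ} (hR : R < W.reportRate pX pR q) : W.Achievable R := by
  obtain ⟨R', hR1, hR2⟩ := exists_between hR
  have hfit : ∃ B : ℕ, ∀ᶠ n : ℕ in atTop, ⌈(2 : ℝ) ^ ((n : ℝ) * R)⌉₊ ≤
      ⌈(2 : ℝ) ^ (((n / (B + 1) : ℕ) : ℝ) * R')⌉₊ ^ B := by
    rcases le_or_gt R 0 with hR0 | hR0
    · refine ⟨0, Eventually.of_forall fun n => ?_⟩
      rw [pow_zero, Nat.ceil_le, Nat.cast_one]
      exact Real.rpow_le_one_of_one_le_of_nonpos (by norm_num)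
        (mul_nonpos_of_nonneg_of_nonpos (Nat.cast_nonneg n) hR0)
    · obtain ⟨B, hB⟩ := exists_nat_gt (R / (R' - R))
      rw [div_lt_iff₀ (by linarith)] at hB
      have hdiv : Tendsto (fun n : ℕ => n / (B + 1)) atTop atTop :=
        Nat.tendsto_div_const_atTop (Nat.succ_ne_zero B)
      obtain ⟨m₀, hm₀⟩ := exists_nat_gt ((B + 1) * R / (B * (R' - R) - R))
      rw [div_lt_iff₀ (by linarith)] at hm₀
      refine ⟨B, (hdiv.eventually_ge_atTop m₀).mono fun n hn => ?_⟩
      set m := n / (B + 1) with hm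
      have hmm : (m₀ : ℝ) ≤ m := by exact_mod_cast hn
      have hnm : (n : ℝ) ≤ (m + 1) * (B + 1) := by
        have := Nat.lt_mul_div_succ n (Nat.succ_pos B)
        have h' : n ≤ (m + 1) * (B + 1) := by
          rw [mul_comm]; exact this.le
        exact_mod_cast h'
      rw [Nat.ceil_le]
      push_cast
      calc (2 : ℝ) ^ ((n : ℝ) * R) ≤ 2 ^ ((m : ℝ) * R' * B) := by
            apply Real.rpow_le_rpow_of_exponent_le (by norm_num)
            have h1 : (m₀ : ℝ) * (B * (R' - R) - R) ≤ m * (B * (R' - R) - R) :=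
              mul_le_mul_of_nonneg_right hmm (by linarith)
            have h2 : (n : ℝ) * R ≤ (m + 1) * (B + 1) * R :=
              mul_le_mul_of_nonneg_right hnm hR0.le
            nlinarith
        _ = ((2 : ℝ) ^ ((m : ℝ) * R')) ^ B := Real.rpow_mul_natCast (by norm_num) _ _
        _ ≤ _ := by gcongr; exact Nat.le_ceil _
  obtain ⟨B, hB⟩ := hfit
  obtain ⟨ε, hε, hcode⟩ := W.exists_blockCodes hpX hpR hq hi hR2 B
  have hMpos : ∀ n : ℕ, 0 < ⌈(2 : ℝ) ^ ((n : ℝ) * R)⌉₊ :=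
    fun n => Nat.ceil_pos.2 (by positivity)
  have hex : ∀ n : ℕ, ∃ c : RelayCode X Y XR YR n ⌈(2 : ℝ) ^ ((n : ℝ) * R)⌉₊,
      ⌈(2 : ℝ) ^ ((n : ℝ) * R)⌉₊ ≤ ⌈(2 : ℝ) ^ (((n / (B + 1) : ℕ) : ℝ) * R')⌉₊ ^ B →
        c.errorProb W ≤ ε (n / (B + 1)) := by
    intro n
    have h := hcode (n / (B + 1)) (n % (B + 1)) ⌈(2 : ℝ) ^ ((n : ℝ) * R)⌉₊ (hMpos n)
    rw [Nat.div_add_mod] at h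
    by_cases hn : ⌈(2 : ℝ) ^ ((n : ℝ) * R)⌉₊ ≤
        ⌈(2 : ℝ) ^ (((n / (B + 1) : ℕ) : ℝ) * R')⌉₊ ^ B
    · obtain ⟨c, hc⟩ := h hn
      exact ⟨c, fun _ => hc⟩
    -- For the finitely many other lengths any code will do.
    · have : Nonempty X := nonempty_of_mem_stdSimplex hpX
      have : ∀ i, Nonempty (XR i) := fun i => nonempty_of_mem_stdSimplex (hpR i)
      exact ⟨⟨fun _ _ => Classical.arbitrary X, fun i _ _ => Classical.arbitrary (XR i),
        fun _ => ⟨0, hMpos n⟩⟩, fun h => absurd h hn⟩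
  choose c hc using hex
  refine ⟨c, squeeze_zero' (Eventually.of_forall fun n => (c n).errorProb_nonneg W)
    (hB.mono fun n hn => hc n hn)
    (hε.comp (Nat.tendsto_div_const_atTop (Nat.succ_ne_zero B)))⟩

/-- Rates below `rateBound` are achievable. The fractions `q i` are first lowered a little wherever
`I(Xᵢ; Y) > 0`, so that the reports need strictly less than `I(Xᵢ; Y)` bits. -/
theorem achievable_of_lt_rateBound (hpX : pX ∈ stdSimplex ℝ X)
    (hpR : ∀ i, pR i ∈ stdSimplex ℝ (XR i)) {R : ℝ} (hR : R < W.rateBound pX pR) :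
    W.Achievable R := by
  set s : Fin N → ℝ := fun i => if W.linkInfo pX pR i = 0 then 0 else 1 with hs
  set q' : ℝ → Fin N → ℝ := fun η i => (1 - η * s i) * W.q pX pR i with hq'
  have hI : ∀ i, 0 ≤ W.linkInfo pX pR i := fun i =>
    mutualInfo_nonneg (W.joint_nonneg hpX hpR) (W.sum_joint hpX hpR) _ _
  have hH : ∀ i, 0 ≤ W.reportEntropy pX pR i := fun i =>
    condEntropy_nonneg (W.joint_nonneg hpX hpR) _ _
  have hqdef : ∀ i, W.q pX pR i = if W.reportEntropy pX pR i = 0 then 1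
      else min 1 (W.linkInfo pX pR i / W.reportEntropy pX pR i) := fun i => rfl
  have hq01 : ∀ i, W.q pX pR i ∈ Set.Icc (0 : ℝ) 1 := by
    intro i
    rw [hqdef]
    split_ifs
    · simp
    · exact ⟨le_min zero_le_one (div_nonneg (hI i) (hH i)), min_le_left _ _⟩
  have hqH : ∀ i, W.q pX pR i * W.reportEntropy pX pR i ≤ W.linkInfo pX pR i := by
    intro i
    rw [hqdef]
    split_ifs with h
    · rw [h, mul_zero]; exact hI i
    · exact (mul_le_mul_of_nonneg_right (min_le_right _ _) (hH i)).trans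
        (div_mul_cancel₀ _ h).le
  have hcont : Continuous fun η => W.reportRate pX pR (q' η) := by
    unfold reportRate subsetProb
    simp only [hq']
    fun_prop
  have h0 : W.reportRate pX pR (q' 0) = W.rateBound pX pR := by
    simp only [hq', zero_mul, sub_zero, one_mul]
    rfl
  have hev : ∀ᶠ η in 𝓝[>] (0 : ℝ), R < W.reportRate pX pR (q' η) :=
    (hcont.tendsto 0).mono_left nhdsWithin_le_nhds |>.eventually_const_lt (by rw [h0]; exact hR)
  obtain ⟨η, hη, hη0, hη1⟩ := (hev.and (Ioo_mem_nhdsGT (zero_lt_one (α := ℝ)))).exists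
  have hfac : ∀ i, 0 ≤ 1 - η * s i ∧ 1 - η * s i ≤ 1 := by
    intro i
    simp only [hs]
    split_ifs <;> constructor <;> linarith
  refine W.achievable_of_lt_reportRate hpX hpR (q := q' η)
    (fun i => ⟨mul_nonneg (hfac i).1 (hq01 i).1,
      mul_le_one₀ (hfac i).2 (hq01 i).1 (hq01 i).2⟩) (fun i => ?_) hη
  simp only [hq', mul_assoc]
  by_cases hIi : W.linkInfo pX pR i = 0
  · refine Or.inr ⟨hIi, ?_⟩
    rw [le_antisymm ((hqH i).trans_eq hIi) (mul_nonneg (hq01 i).1 (hH i)), mul_zero]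
  · have hpos : 0 < W.linkInfo pX pR i := lt_of_le_of_ne (hI i) (Ne.symm hIi)
    refine Or.inl ?_
    simp only [hs, if_neg hIi, mul_one]
    calc (1 - η) * (W.q pX pR i * W.reportEntropy pX pR i) ≤ (1 - η) * W.linkInfo pX pR i :=
          mul_le_mul_of_nonneg_left (hqH i) (by linarith)
      _ < W.linkInfo pX pR i := by nlinarith

end RelayChannel

end

theorem mainTheorem2 {N : ℕ} {X Y : Type*} {XR YR : Fin N → Type*}
    [Fintype X] [Fintype Y] [∀ i, Fintype (XR i)] [∀ i, Fintype (YR i)]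
    (W : RelayChannel N X Y XR YR)
    (pX : X → ℝ) (hpX : pX ∈ stdSimplex ℝ X)
    (pR : ∀ i, XR i → ℝ) (hpR : ∀ i, pR i ∈ stdSimplex ℝ (XR i)) (R : ℝ) :
    (R < W.rateBound pX pR → W.Achievable R) ∧
      (R ≤ W.rateBound pX pR → R ∈ closure {r : ℝ | W.Achievable r}) := by
  refine ⟨W.achievable_of_lt_rateBound hpX hpR, fun hR => ?_⟩
  have hsub : Set.Iio (W.rateBound pX pR) ⊆ {r : ℝ | W.Achievable r} :=
    fun r hr => W.achievable_of_lt_rateBound hpX hpR hr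
  refine closure_mono hsub ?_
  rw [closure_Iio]
  exact hR
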